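/- A computable linear order is a linear order with universe $\mathbb{N}$ whose order relation is computable; a computable copy of $L$ is a computable linear order isomorphic to $L$. In a linear order, let $B(x,y)$ hold when the closed interval between $x$ and $y$ is finite. This is an equivalence relation, the block relation; its classes are called blocks, and they inherit a linear order, whose order-type is the condensation-type of the order. Let $\eta$ be the order-type of the rationals. A linear order is strongly $\eta$-like if it has condensation-type $\eta$ and, for some finite $k$, all its blocks have fewer than $k$ elements. An interval is a convex subset. A $\Pi_1$ copy of a linear order is a suborder, isomorphic to it, of some computable linear order, whose set of elements is a $\Pi_1$ subset of $\mathbb{N}$. There is a computable linear order $L$ such that 1. $L$ has condensation-type $\eta$ (in particular its condensation-type is dense); 2. no infinite interval of $L$ is strongly $\eta$-like; 3. no computable copy of $L$ has a computably enumerable block relation $B(x,y)$. Moreover, $L$ can be taken of the following form: there are a computable linear order $E$ of type $\eta$ and a $\Pi_2$ set $A\subseteq\mathbb{N}$ such that the suborder of $E$ with set of elements $A$ has no $\Pi_1$ copy, and $L$ is obtained, up to isomorphism, from $E$ by replacing each $i\in A$ with a block of size $p_i$, the $i$-th prime ($p_0=2$), and each $i\notin A$ with a block of type $\omega^*+\omega$.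 -/

import Mathlib

namespace BlockOrder

noncomputable section

/-! ### Blocks, the finite condensation, strongly `η`-like orders -/

/-- The block relation `B(x, y)`: the closed interval between `x` and `y` is finite. -/
def BlockRel {α : Type*} [LinearOrder α] (x y : α) : Prop :=
  (Set.uIcc x y).Finite

theorem blockRel_equivalence (α : Type*) [LinearOrder α] :
    Equivalence (BlockRel (α := α)) where
  refl x := by simp [BlockRel]
  symm {x y} h := by rwa [BlockRel, Set.uIcc_comm]
  trans {x y z} h₁ h₂ := (h₁.union h₂).subset Set.uIcc_subset_uIcc_union_uIcc

/-- The equivalence relation whose classes are the blocks of `α`. -/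
def blockSetoid (α : Type*) [LinearOrder α] : Setoid α :=
  ⟨BlockRel, blockRel_equivalence α⟩

/-- The finite condensation of `α`: its set of blocks. -/
def Condensation (α : Type*) [LinearOrder α] : Type _ :=
  Quotient (blockSetoid α)

/-- The block of `x`, as a point of the finite condensation. -/
def toCondensation {α : Type*} [LinearOrder α] (x : α) : Condensation α :=
  Quotient.mk (blockSetoid α) x

theorem toCondensation_eq_iff {α : Type*} [LinearOrder α] {x y : α} :
    toCondensation x = toCondensation y ↔ BlockRel x y :=
  Quotient.eq (r := blockSetoid α)

theorem BlockRel.of_le_of_le {α : Type*} [LinearOrder α] {x y z w : α}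
    (hxy : x ≤ y) (hzw : z ≤ w) (hxw : BlockRel x w) (hyz : BlockRel y z) :
    BlockRel x y := by
  have hE := blockRel_equivalence α
  rcases le_total y w with h | h
  · refine Set.Finite.subset hxw ?_
    rw [Set.uIcc_of_le hxy, Set.uIcc_of_le (hxy.trans h)]
    exact Set.Icc_subset_Icc_right h
  · have hyw : BlockRel w y := by
      refine Set.Finite.subset hyz ?_
      rw [Set.uIcc_of_le h, Set.uIcc_of_ge (hzw.trans h)]
      exact Set.Icc_subset_Icc_left hzw
    exact hE.trans hxw hyw

/-- Blocks are ordered as their elements are: a block is below another one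
if some element of the first is at most some element of the second. -/
instance (α : Type*) [LinearOrder α] : LinearOrder (Condensation α) where
  le a b := ∃ x y : α, toCondensation x = a ∧ toCondensation y = b ∧ x ≤ y
  le_refl a := by
    obtain ⟨x, rfl⟩ := Quotient.exists_rep a
    exact ⟨x, x, rfl, rfl, le_rfl⟩
  le_trans := by
    rintro a b c ⟨x, y, rfl, rfl, hxy⟩ ⟨z, w, hzy, rfl, hzw⟩
    have hyz : BlockRel y z := (toCondensation_eq_iff.1 hzy.symm)
    rcases le_total x w with h | h
    · exact ⟨x, w, rfl, rfl, h⟩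
    · have hzx : BlockRel w x := by
        refine Set.Finite.subset hyz ?_
        rw [Set.uIcc_of_le h, Set.uIcc_of_ge ((hzw.trans h).trans hxy)]
        exact Set.Icc_subset_Icc hzw hxy
      exact ⟨x, x, rfl, (toCondensation_eq_iff.2 hzx).symm, le_rfl⟩
  le_antisymm := by
    rintro a b ⟨x, y, rfl, rfl, hxy⟩ ⟨z, w, hz, hw, hzw⟩
    exact toCondensation_eq_iff.2 (BlockRel.of_le_of_le hxy hzw
      (toCondensation_eq_iff.1 hw.symm) (toCondensation_eq_iff.1 hz.symm))
  le_total a b := by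
    obtain ⟨x, rfl⟩ := Quotient.exists_rep a
    obtain ⟨y, rfl⟩ := Quotient.exists_rep b
    exact (le_total x y).imp (fun h => ⟨x, y, rfl, rfl, h⟩) (fun h => ⟨y, x, rfl, rfl, h⟩)
  toDecidableLE := Classical.decRel _

/-- `α` has condensation-type `η`, the order-type of the rationals. -/
def HasCondensationTypeEta (α : Type*) [LinearOrder α] : Prop :=
  Nonempty (Condensation α ≃o ℚ)

/-- `α` is strongly `η`-like: its condensation-type is `η`, and all its blocks have
fewer than `k` elements, for some fixed finite `k`. -/
def StronglyEtaLike (α : Type*) [LinearOrder α] : Prop :=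
  HasCondensationTypeEta α ∧ ∃ k : ℕ, ∀ x : α, {y : α | BlockRel x y}.encard < k

/-! ### Computable linear orders, `Π₁` and `Π₂` suborders -/

/-- A computable linear order: a linear order with universe `ℕ` whose (strict) order
relation is computable. -/
structure ComputableLinearOrder where
  order : LinearOrder ℕ
  computable_lt : ComputablePred fun p : ℕ × ℕ => order.lt p.1 p.2

/-- The universe `ℕ` of `L`, as a type that carries the order of `L`. -/
def ComputableLinearOrder.Carrier (L : ComputableLinearOrder) : Type := ℕ

instance : CoeSort ComputableLinearOrder Type := ⟨ComputableLinearOrder.Carrier⟩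

instance (L : ComputableLinearOrder) : LinearOrder L := L.order

/-- The natural number `n` as an element of `L`. -/
def ComputableLinearOrder.elem (L : ComputableLinearOrder) (n : ℕ) : L := n

/-- The block relation of `L` is computably enumerable. -/
def ComputableLinearOrder.HasCEBlockRel (L : ComputableLinearOrder) : Prop :=
  REPred fun p : ℕ × ℕ => BlockRel (L.elem p.1) (L.elem p.2)

/-- `A` is a `Π₁` set of natural numbers. -/
def IsPi1 (A : Set ℕ) : Prop :=
  ∃ R : ℕ → ℕ → Prop, (ComputablePred fun q : ℕ × ℕ => R q.1 q.2) ∧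
    ∀ n, n ∈ A ↔ ∀ a, R n a

/-- `A` is a `Π₂` set of natural numbers. -/
def IsPi2 (A : Set ℕ) : Prop :=
  ∃ R : ℕ → ℕ → ℕ → Prop, (ComputablePred fun q : ℕ × ℕ × ℕ => R q.1 q.2.1 q.2.2) ∧
    ∀ n, n ∈ A ↔ ∀ a, ∃ b, R n a b

/-- The suborder of `L` whose set of elements is `A`. -/
abbrev ComputableLinearOrder.Suborder (L : ComputableLinearOrder) (A : Set ℕ) : Type :=
  {x : L // ∃ n ∈ A, L.elem n = x}

/-- The linear order `α` has a `Π₁` copy: it is isomorphic to the suborder of a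
computable linear order that is given by a `Π₁` subset of the universe. -/
def HasPi1Copy (α : Type*) [LinearOrder α] : Prop :=
  ∃ (M : ComputableLinearOrder) (P : Set ℕ), IsPi1 P ∧ Nonempty (M.Suborder P ≃o α)

/-- `L` is obtained from `E` by replacing each element `n` of `A` with a block whose size
is the `n`-th prime (counting from `p₀ = 2`), and each `n ∉ A` with a block of type
`ω* + ω`, the order-type of the integers. The map `f` sends an element of `L` to the
element of `E` which the block around it has replaced. -/
def IsPrimeBlockReplacement (L E : ComputableLinearOrder) (A : Set ℕ) : Prop :=
  ∃ f : L → E, Monotone f ∧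
    (∀ n ∈ A, Nonempty ({x : L // f x = E.elem n} ≃o Fin (Nat.nth Nat.Prime n))) ∧
    ∀ n ∉ A, Nonempty ({x : L // f x = E.elem n} ≃o ℤ)

end

end BlockOrder

/-!
The argument has two halves, joined by the lexicographic product `E × η`.

*Coding.* The set `DiagPi4` is `Π₄` but not `Σ₄`, by diagonalisation (`not_isSigma_diagPi4`). It is
coded into a `Π₂` suborder `Coding` of a computable linear order, whose order-type is a sum over
`n` of `η` followed by a finite run of consecutive points. The run has `2n + 2` points if
`DiagPi4 n` holds, and one more otherwise. Indeed, `DiagPi4 n` has the form `∀ a, ∃ b, Π₂`; a `Π₂` suborder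
can make a place inhabited exactly if there is a `b` for a given `a`, by giving it one potential
inhabitant for each `b`. The first of the `2n + 2` points is approached from below by a sequence of
places, the `a`-th of which is inhabited if there are such `b` for all smaller indices. If all of
them are inhabited, the point is a limit; otherwise it gets an immediate predecessor. In a `Π₁`
suborder of a computable linear order, by contrast, to have a maximal run of a given length is only
a `Σ₄` property (`isSigma_hasRun`). So `Coding` has no `Π₁` copy.

*Replacement.* For every `Π₂` set `A` of points of a computable linear order `E`, the points of
`E × η` can be replaced with blocks in a computable way, so that the centres `(i, 0)` with `i ∈ A` get
blocks of prime size and all the other points get blocks of type `ω* + ω`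
(`exists_isPrimeBlockReplacement`). Write `i ∈ A` as `∀ t, G i t`, with `G i` decreasing and c.e.
Around the finite block of the centre `(i, 0)`, an `ω`-chain is put immediately on its right and an
`ω*`-chain immediately on its left; these are the chains of stage `0`. When `G i t` is found to
hold, the chains of stage `t` are released, and those of stage `t + 1` are put between them and the
centre. On release, the chains are completed to `ω* + ω`, and densely many further blocks of that
type are put around them. If `i ∈ A`, every stage is released, and the centre keeps its finite
block. Otherwise the chains of the first stage that is not released stay next to it, and turn its
block into one of type `ω* + ω`. The result is a c.e. subset of a computable linear order, and
therefore has a computable copy (`exists_orderIso_suborder`).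

The blocks of the resulting order `L` are the fibres of the map to `E × η`, so its
condensation-type is `η`. An interval that meets two blocks contains blocks of arbitrarily large
size (`IsPrimeBlockReplacement.not_stronglyEtaLike`). If a computable copy of `L` had a c.e. block
relation, then the left ends of its blocks would form a `Π₁` set. Blocks of type `ω* + ω` have no
left end, so this would be a `Π₁` copy of the suborder `A`, hence of `Coding`
(`IsPrimeBlockReplacement.hasPi1Copy`).
-/

namespace BlockOrder

/-! ### The arithmetical hierarchy -/

open Nat.Partrec (Code)

/-- The predicate `p` is `Σ_k`. Level `0` consists of the computable predicates, and a `Σ_{k+1}`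
predicate is an existential number quantifier over the complement of a `Σ_k` predicate. -/
def IsSigma : ℕ → ∀ {α : Type} [Primcodable α], (α → Prop) → Prop
  | 0, _, _, p => ComputablePred p
  | k + 1, α, _, p => ∃ q : α × ℕ → Prop, IsSigma k (fun x => ¬ q x) ∧ ∀ x, p x ↔ ∃ n, q (x, n)

/-- The predicate `p` is `Π_k`, that is, its complement is `Σ_k`. -/
def IsPi (k : ℕ) {α : Type} [Primcodable α] (p : α → Prop) : Prop :=
  IsSigma k fun x => ¬ p x

section Hierarchy

variable {α β : Type} [Primcodable α] [Primcodable β] {k : ℕ}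

theorem IsSigma.congr {p q : α → Prop} (hp : IsSigma k p) (h : ∀ x, q x ↔ p x) : IsSigma k q := by
  rwa [show q = p from funext fun x => propext (h x)]

theorem IsPi.congr {p q : α → Prop} (hp : IsPi k p) (h : ∀ x, q x ↔ p x) : IsPi k q :=
  IsSigma.congr (k := k) hp fun x => not_congr (h x)

theorem IsPi.not {p : α → Prop} (hp : IsPi k p) : IsSigma k fun x => ¬ p x := hp

theorem IsSigma.not {p : α → Prop} (hp : IsSigma k p) : IsPi k fun x => ¬ p x :=
  hp.congr fun _ => not_not

theorem isSigma_zero {p : α → Prop} : IsSigma 0 p ↔ ComputablePred p := Iff.rfl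

theorem isPi_zero {p : α → Prop} : IsPi 0 p ↔ ComputablePred p :=
  ⟨fun h => (ComputablePred.not h).of_eq fun _ => not_not, fun h => h.not⟩

theorem IsSigma.comp {p : β → Prop} (hp : IsSigma k p) {f : α → β} (hf : Computable f) :
    IsSigma k fun x => p (f x) := by
  induction k generalizing α β with
  | zero =>
    obtain ⟨_, h⟩ := hp
    exact ⟨fun x => inferInstanceAs (Decidable (p (f x))), h.comp hf⟩
  | succ k ih =>
    obtain ⟨q, hq, h⟩ := hp
    exact ⟨fun x => q (f x.1, x.2), ih hq ((hf.comp Computable.fst).pair Computable.snd),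
      fun x => h (f x)⟩

theorem _root_.ComputablePred.comp_computable {p : β → Prop} (hp : ComputablePred p) {f : α → β}
    (hf : Computable f) : ComputablePred fun x => p (f x) :=
  isSigma_zero.1 ((isSigma_zero.2 hp).comp hf)

theorem IsPi.comp {p : β → Prop} (hp : IsPi k p) {f : α → β} (hf : Computable f) :
    IsPi k fun x => p (f x) :=
  IsSigma.comp (k := k) hp hf

theorem IsPi.exists {p : α × ℕ → Prop} (hp : IsPi k p) : IsSigma (k + 1) fun x => ∃ n, p (x, n) :=
  ⟨p, hp, fun _ => Iff.rfl⟩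

theorem IsSigma.forall {p : α × ℕ → Prop} (hp : IsSigma k p) :
    IsPi (k + 1) fun x => ∀ n, p (x, n) :=
  hp.not.exists.congr fun _ => not_forall

theorem IsPi.isSigma_succ {p : α → Prop} (hp : IsPi k p) : IsSigma (k + 1) p :=
  (hp.comp (f := fun x : α × ℕ => x.1) Computable.fst).exists.congr fun _ => by simp

theorem IsSigma.succ {p : α → Prop} (hp : IsSigma k p) : IsSigma (k + 1) p := by
  induction k generalizing α with
  | zero => exact (isPi_zero.2 hp).isSigma_succ
  | succ k ih =>
    obtain ⟨q, hq, h⟩ := hp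
    exact ⟨q, ih hq, h⟩

theorem IsPi.succ {p : α → Prop} (hp : IsPi k p) : IsPi (k + 1) p :=
  IsSigma.succ (k := k) hp

theorem IsSigma.of_computablePred {p : α → Prop} (hp : ComputablePred p) : IsSigma k p := by
  induction k with
  | zero => exact hp
  | succ k ih => exact ih.succ

theorem IsPi.of_computablePred {p : α → Prop} (hp : ComputablePred p) : IsPi k p :=
  IsSigma.of_computablePred hp.not

theorem _root_.ComputablePred.and_computable {p q : α → Prop} (hp : ComputablePred p)
    (hq : ComputablePred q) :
    ComputablePred fun x => p x ∧ q x := by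
  obtain ⟨_, hp⟩ := hp
  obtain ⟨_, hq⟩ := hq
  refine ⟨fun x => inferInstanceAs (Decidable (p x ∧ q x)), ?_⟩
  refine (Primrec.and.to_comp.comp hp hq).of_eq fun x => ?_
  simp

theorem IsSigma.and_or (k : ℕ) : ∀ {α : Type} [Primcodable α] {p q : α → Prop}, IsSigma k p →
    IsSigma k q → IsSigma k (fun x => p x ∧ q x) ∧ IsSigma k (fun x => p x ∨ q x) := by
  induction k with
  | zero =>
    intro α _ p q hp hq
    refine ⟨ComputablePred.and_computable hp hq, ?_⟩
    exact (ComputablePred.and_computable (ComputablePred.not hp) (ComputablePred.not hq)).not.of_eq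
      fun x => by tauto
  | succ k ih =>
    rintro α _ p q ⟨p', hp, hp'⟩ ⟨q', hq, hq'⟩
    constructor
    · have h1 := hp.comp (f := fun x : α × ℕ => (x.1, x.2.unpair.1))
        (Computable.fst.pair (Computable.fst.comp (Computable.unpair.comp Computable.snd)))
      have h2 := hq.comp (f := fun x : α × ℕ => (x.1, x.2.unpair.2))
        (Computable.fst.pair (Computable.snd.comp (Computable.unpair.comp Computable.snd)))
      refine ⟨fun x => p' (x.1, x.2.unpair.1) ∧ q' (x.1, x.2.unpair.2),
        (ih h1 h2).2.congr fun x => not_and_or, fun x => ?_⟩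
      simp only [hp', hq']
      constructor
      · rintro ⟨⟨a, ha⟩, b, hb⟩
        exact ⟨Nat.pair a b, by simpa using ⟨ha, hb⟩⟩
      · rintro ⟨n, ha, hb⟩
        exact ⟨⟨_, ha⟩, _, hb⟩
    · refine ⟨fun x => p' x ∨ q' x, (ih hp hq).1.congr fun x => not_or, fun x => ?_⟩
      simp only [hp', hq', exists_or]

variable {p q : α → Prop}

theorem IsSigma.and (hp : IsSigma k p) (hq : IsSigma k q) : IsSigma k fun x => p x ∧ q x :=
  (IsSigma.and_or k hp hq).1

theorem IsSigma.or (hp : IsSigma k p) (hq : IsSigma k q) : IsSigma k fun x => p x ∨ q x :=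
  (IsSigma.and_or k hp hq).2

theorem IsPi.and (hp : IsPi k p) (hq : IsPi k q) : IsPi k fun x => p x ∧ q x :=
  (IsSigma.or (k := k) hp hq).congr fun _ => not_and_or

theorem IsPi.or (hp : IsPi k p) (hq : IsPi k q) : IsPi k fun x => p x ∨ q x :=
  (IsSigma.and (k := k) hp hq).congr fun _ => not_or

theorem IsPi.imp (hp : IsSigma k p) (hq : IsPi k q) : IsPi k fun x => p x → q x :=
  (hp.not.or hq).congr fun _ => imp_iff_not_or

theorem IsSigma.imp (hp : IsPi k p) (hq : IsSigma k q) : IsSigma k fun x => p x → q x :=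
  (hp.not.or hq).congr fun _ => imp_iff_not_or

theorem IsSigma.exists {p : α × ℕ → Prop} (hp : IsSigma (k + 1) p) :
    IsSigma (k + 1) fun x => ∃ n, p (x, n) := by
  obtain ⟨q, hq, h⟩ := hp
  have h2 := hq.not.comp (f := fun x : α × ℕ => ((x.1, x.2.unpair.1), x.2.unpair.2))
    ((Computable.fst.pair (Computable.fst.comp (Computable.unpair.comp Computable.snd))).pair
      (Computable.snd.comp (Computable.unpair.comp Computable.snd)))
  refine h2.exists.congr fun x => ?_
  simp only [h, not_not]
  constructor
  · rintro ⟨a, b, hab⟩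
    exact ⟨Nat.pair a b, by simpa using hab⟩
  · rintro ⟨n, hn⟩
    exact ⟨_, _, hn⟩

theorem IsPi.forall {p : α × ℕ → Prop} (hp : IsPi (k + 1) p) :
    IsPi (k + 1) fun x => ∀ n, p (x, n) :=
  (IsSigma.exists (k := k) hp).congr fun _ => not_forall

theorem _root_.ComputablePred.forall_lt {p : α × ℕ → Prop} (hp : ComputablePred p) :
    ComputablePred fun x : α × ℕ => ∀ m < x.2, p (x.1, m) := by
  classical
  obtain ⟨_, hp⟩ := hp
  have h : Computable fun x : α × ℕ =>
      Nat.rec (motive := fun _ => Bool) true (fun m b => b && decide (p (x.1, m))) x.2 := by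
    refine Computable.nat_rec (h := fun x y => y.2 && decide (p (x.1, y.1))) Computable.snd
      (Computable.const true) ?_
    exact Primrec.and.to_comp.comp (Computable.snd.comp Computable.snd)
      (hp.comp ((Computable.fst.comp Computable.fst).pair (Computable.fst.comp Computable.snd)))
  refine ⟨fun x => Classical.dec _, h.of_eq fun x => ?_⟩
  obtain ⟨x, n⟩ := x
  induction n with
  | zero => simp
  | succ n ih =>
    simp only [] at ih ⊢
    rw [ih]
    rw [← Bool.decide_and]
    exact decide_eq_decide.2 Nat.forall_lt_succ_right.symm

/-! ### Computably enumerable predicates and a universal predicate -/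

theorem _root_.REPred.exists_code {p : α → Prop} (hp : REPred p) :
    ∃ c : Code, ∀ x, p x ↔ ∃ s, (Code.evaln s c (Encodable.encode x)).isSome := by
  obtain ⟨c, hc⟩ := Code.exists_code.1 hp
  refine ⟨c, fun x => ?_⟩
  have h : p x ↔ (c.eval (Encodable.encode x)).Dom := by
    rw [hc]; simp [Part.assert]
  rw [h, Part.dom_iff_mem]
  constructor
  · rintro ⟨y, hy⟩
    obtain ⟨s, hs⟩ := Code.evaln_complete.1 hy
    exact ⟨s, Option.isSome_iff_exists.2 ⟨y, hs⟩⟩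
  · rintro ⟨s, hs⟩
    obtain ⟨y, hy⟩ := Option.isSome_iff_exists.1 hs
    exact ⟨y, Code.evaln_sound hy⟩

theorem computablePred_evaln {s c x : α → ℕ} (hs : Computable s) (hc : Computable c)
    (hx : Computable x) :
    ComputablePred fun a => (Code.evaln (s a) (Denumerable.ofNat Code (c a)) (x a)).isSome := by
  refine ⟨fun a => inferInstance, ?_⟩
  have h := Primrec.option_isSome.to_comp.comp (Code.primrec_evaln.to_comp.comp
    ((hs.pair ((Computable.ofNat Code).comp hc)).pair hx))
  exact h.of_eq fun a => by simp

theorem IsSigma.of_rePred {p : α → Prop} (hp : REPred p) : IsSigma 1 p := by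
  obtain ⟨c, hc⟩ := REPred.exists_code hp
  have h : ComputablePred fun x : α × ℕ => ((Code.evaln x.2
      (Denumerable.ofNat Code (Encodable.encode c)) (Encodable.encode x.1)).isSome : Prop) :=
    computablePred_evaln Computable.snd (Computable.const _) (Computable.encode.comp Computable.fst)
  refine (IsPi.of_computablePred (k := 0) h).exists.congr fun x => ?_
  simp [hc]

theorem IsSigma.rePred {p : α → Prop} (hp : IsSigma 1 p) : REPred p := by
  obtain ⟨q, hq, h⟩ := hp
  obtain ⟨_, hq⟩ := isPi_zero.1 hq
  have hr : Partrec fun x => Nat.rfind fun n => Part.some (decide (q (x, n))) :=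
    Partrec.rfind (p := fun x n => Part.some (decide (q (x, n)))) hq.partrec
  refine hr.dom_re.of_eq fun x => ?_
  rw [h]
  exact Nat.rfind_dom.trans (by simp)

/-- A `Π₄` set that is not `Σ₄`: the diagonal of the complement of a universal `Σ₄` predicate. -/
def DiagPi4 (n : ℕ) : Prop :=
  ∀ a : ℕ, ∃ b : ℕ, ∀ c : ℕ, ∃ t, (Code.evaln t (Denumerable.ofNat Code n)
    (Encodable.encode (((n, a), b), c))).isSome

theorem not_isSigma_diagPi4 : ¬ IsSigma 4 DiagPi4 := by
  rintro ⟨q₁, ⟨q₂, ⟨q₃, h₃, h₂⟩, h₁⟩, h₀⟩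
  obtain ⟨c, hc⟩ := h₃.rePred.exists_code
  beta_reduce at h₁ h₂
  have h : DiagPi4 (Encodable.encode c) ↔ ∃ a : ℕ, ∀ b : ℕ, ∃ d : ℕ, ¬ ∃ t,
      (Code.evaln t c (Encodable.encode (((Encodable.encode c, a), b), d))).isSome := by
    rw [h₀]
    refine exists_congr fun a => ?_
    rw [← not_iff_not, h₁, not_forall]
    refine exists_congr fun b => ?_
    rw [← not_iff_not, h₂, not_not]
    refine exists_congr fun d => ?_
    rw [← hc, not_not]
  have h' : DiagPi4 (Encodable.encode c) ↔ ∀ a : ℕ, ∃ b : ℕ, ∀ d : ℕ, ∃ t,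
      (Code.evaln t c (Encodable.encode (((Encodable.encode c, a), b), d))).isSome := by
    simp [DiagPi4]
  have h'' := h.symm.trans h'
  by_cases hS : DiagPi4 (Encodable.encode c)
  · obtain ⟨a, ha⟩ := h.1 hS
    obtain ⟨b, hb⟩ := h'.1 hS a
    obtain ⟨d, hd⟩ := ha b
    exact hd (hb d)
  · refine hS (h.2 ?_)
    have := mt h'.2 hS
    push Not at this ⊢
    exact this

end Hierarchy

/-! ### Computable linear orders -/

section ArithmeticForms

variable {α : Type} [Primcodable α]

theorem computablePred_natEq {f g : α → ℕ} (hf : Computable f) (hg : Computable g) :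
    ComputablePred fun x => f x = g x :=
  (Primrec.eq (α := ℕ)).computablePred.comp_computable (hf.pair hg)

theorem computablePred_natLt {f g : α → ℕ} (hf : Computable f) (hg : Computable g) :
    ComputablePred fun x => f x < g x :=
  Primrec.nat_lt.computablePred.comp_computable (hf.pair hg)

theorem isPi1_iff {A : Set ℕ} : IsPi1 A ↔ IsPi 1 fun n => n ∈ A := by
  constructor
  · rintro ⟨R, hR, h⟩
    exact (IsSigma.forall (isSigma_zero.2 hR)).congr h
  · rintro ⟨q, hq, h⟩
    refine ⟨fun n a => ¬ q (n, a), hq, fun n => ?_⟩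
    rw [← not_iff_not, not_forall_not]
    exact h n

theorem isPi2_iff {A : Set ℕ} : IsPi2 A ↔ IsPi 2 fun n => n ∈ A := by
  constructor
  · rintro ⟨R, hR, h⟩
    have h0 : ComputablePred fun x : (ℕ × ℕ) × ℕ => R x.1.1 x.1.2 x.2 :=
      hR.comp_computable (f := fun x : (ℕ × ℕ) × ℕ => (x.1.1, x.1.2, x.2))
        ((Computable.fst.comp Computable.fst).pair
          ((Computable.snd.comp Computable.fst).pair Computable.snd))
    exact (isPi_zero.2 h0).exists.forall.congr h
  · rintro ⟨q, ⟨q', hq', h'⟩, h⟩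
    refine ⟨fun n a b => q' ((n, a), b), isPi_zero.1 (IsPi.comp (k := 0) hq'
      (f := fun x : ℕ × ℕ × ℕ => ((x.1, x.2.1), x.2.2)) ?_), fun n => ?_⟩
    · exact ((Computable.fst.pair (Computable.fst.comp Computable.snd)).pair
        (Computable.snd.comp Computable.snd))
    · rw [← not_iff_not, not_forall]
      exact (h n).trans (exists_congr fun a => not_not.symm.trans (not_congr (h' (n, a))))

/-- The increasing enumeration of an infinite computable set is computable. -/
theorem computable_nth {U : ℕ → Prop} (hU : ComputablePred U) (hinf : {n | U n}.Infinite) :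
    Computable (Nat.nth U) := by
  obtain ⟨_, hU'⟩ := id hU
  have hcount : Computable (Nat.count U) := by
    have : Computable fun n : ℕ => Nat.rec (motive := fun _ => ℕ) 0
        (fun m c => c + bif decide (U m) then 1 else 0) n := by
      refine Computable.nat_rec (f := fun n : ℕ => n) (g := fun _ => 0)
        (h := fun _ y => y.2 + bif decide (U y.1) then 1 else 0) Computable.id
        (Computable.const 0) ?_
      refine Primrec.nat_add.to_comp.comp (Computable.snd.comp Computable.snd) ?_
      exact Computable.cond (hU'.comp (Computable.fst.comp Computable.snd)) (Computable.const 1)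
        (Computable.const 0)
    refine this.of_eq fun n => ?_
    induction n with
    | zero => simp
    | succ n ih => simp only [] at ih ⊢; rw [ih, Nat.count_succ]; by_cases h : U n <;> simp [h]
  have hp : ComputablePred fun x : ℕ × ℕ => U x.2 ∧ Nat.count U x.2 = x.1 :=
    (hU.comp_computable Computable.snd).and_computable
      (computablePred_natEq (hcount.comp Computable.snd) Computable.fst)
  obtain ⟨_, hp⟩ := hp
  have hr : Partrec fun x : ℕ => Nat.rfind fun n =>
      Part.some (decide (U n ∧ Nat.count U n = x)) :=
    Partrec.rfind (p := fun x n => Part.some (decide (U n ∧ Nat.count U n = x)))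
      (Computable.of_eq hp fun _ => decide_eq_decide.2 Iff.rfl).partrec
  refine hr.of_eq_tot fun n => ?_
  refine Nat.mem_rfind.2 ⟨?_, fun {m} hm => ?_⟩
  · simp [Nat.nth_mem_of_infinite hinf, Nat.count_nth_of_infinite hinf]
  · simp only [Part.mem_some_iff, Bool.false_eq, decide_eq_false_iff_not]
    rintro ⟨h1, h2⟩
    rw [← h2, Nat.nth_count h1] at hm
    exact lt_irrefl _ hm

theorem computable_nth_prime : Computable (Nat.nth Nat.Prime) := by
  have h : ComputablePred fun n : ℕ => 2 ≤ n ∧ ∀ m < n, ∀ k < n, m * k ≠ n := by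
    have h1 : ComputablePred fun x : (ℕ × ℕ) × ℕ => ¬ x.1.2 * x.2 = x.1.1 :=
      (computablePred_natEq (Primrec.nat_mul.to_comp.comp
        (Computable.snd.comp Computable.fst) Computable.snd)
        (Computable.fst.comp Computable.fst)).not
    have h2 := h1.forall_lt.comp_computable
      (f := fun x : ℕ × ℕ => (x, x.1)) (Computable.id.pair Computable.fst)
    have h3 := h2.forall_lt.comp_computable
      (f := fun x : ℕ => (x, x)) (Computable.id.pair Computable.id)
    exact (computablePred_natLt (Computable.const 1) Computable.id).and_computable h3
  refine computable_nth (h.of_eq fun n => ?_) Nat.infinite_setOfPred_prime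
  constructor
  · rintro ⟨h2, h⟩
    rw [Nat.prime_def_lt]
    refine ⟨h2, fun m hm ⟨k, hk⟩ => ?_⟩
    by_contra hm1
    refine h m hm k ?_ hk.symm
    have : 0 < k := Nat.pos_of_ne_zero (by rintro rfl; omega)
    have : 2 ≤ m := by
      rcases m with _ | _ | m
      · omega
      · omega
      · omega
    nlinarith
  · intro hn
    refine ⟨hn.two_le, fun m hm k hk h => ?_⟩
    rcases hn.eq_one_or_self_of_dvd m ⟨k, h.symm⟩ with rfl | rfl
    · omega
    · omega

end ArithmeticForms

namespace ComputableLinearOrder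

/-- The natural number that an element of `L` is. -/
def num {L : ComputableLinearOrder} (x : L) : ℕ := x

@[simp] theorem num_elem (L : ComputableLinearOrder) (n : ℕ) : num (L.elem n) = n := rfl

@[simp] theorem elem_num {L : ComputableLinearOrder} (x : L) : L.elem (num x) = x := rfl

theorem elem_injective (L : ComputableLinearOrder) : Function.Injective L.elem :=
  fun _ _ h => h

@[simp] theorem elem_inj (L : ComputableLinearOrder) {m n : ℕ} : L.elem m = L.elem n ↔ m = n :=
  L.elem_injective.eq_iff

instance (L : ComputableLinearOrder) : Countable L := inferInstanceAs (Countable ℕ)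

theorem computablePred_lt {α : Type} [Primcodable α] (L : ComputableLinearOrder) {f g : α → ℕ}
    (hf : Computable f) (hg : Computable g) :
    ComputablePred fun x => L.elem (f x) < L.elem (g x) :=
  L.computable_lt.comp_computable (hf.pair hg)

/-- The computable linear order that an injection into a linear order induces on `ℕ`, when
the induced relation is computable. -/
def ofInjective {α : Type*} [LinearOrder α] (κ : ℕ → α) (hκ : Function.Injective κ)
    (h : ComputablePred fun p : ℕ × ℕ => κ p.1 < κ p.2) : ComputableLinearOrder where
  order := LinearOrder.lift' κ hκ
  computable_lt := h

theorem ofInjective_lt {α : Type*} [LinearOrder α] {κ : ℕ → α} {hκ : Function.Injective κ}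
    {h : ComputablePred fun p : ℕ × ℕ => κ p.1 < κ p.2} {m n : ℕ} :
    (ofInjective κ hκ h).elem m < (ofInjective κ hκ h).elem n ↔ κ m < κ n :=
  Iff.rfl

/-- Every infinite c.e. subset of a computable linear order has a computable copy. -/
theorem exists_orderIso_suborder (K : ComputableLinearOrder) {W : Set ℕ}
    (hW : IsSigma 1 fun n => n ∈ W) (hinf : W.Infinite) :
    ∃ L : ComputableLinearOrder, Nonempty (L ≃o K.Suborder W) := by
  obtain ⟨q, hq, h⟩ := hW
  replace hq := isPi_zero.1 hq
  -- A pair codes an element of `W` together with the least witness that it is one, so that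
  -- the set `U` of these pairs is computable and each element of `W` occurs exactly once.
  let U : ℕ → Prop := fun n => q n.unpair ∧ ∀ m < n.unpair.2, ¬ q (n.unpair.1, m)
  have hU : ComputablePred U :=
    (hq.comp_computable Computable.unpair).and_computable
      ((ComputablePred.not hq).forall_lt.comp_computable Computable.unpair)
  have hex : ∀ w ∈ W, ∃ n, U n ∧ n.unpair.1 = w := by
    classical
    intro w hw
    have hw' := (h w).1 hw
    exact ⟨Nat.pair w (Nat.find hw'), by
      simp only [U, Nat.unpair_pair]
      exact ⟨⟨Nat.find_spec hw', fun m hm => Nat.find_min hw' hm⟩, trivial⟩⟩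
  have hUW : ∀ n, U n → n.unpair.1 ∈ W := fun n hn => (h _).2 ⟨_, hn.1⟩
  have hinj : ∀ m n, U m → U n → m.unpair.1 = n.unpair.1 → m = n := by
    intro m n hm hn hmn
    have : m.unpair.2 = n.unpair.2 := by
      rcases lt_trichotomy m.unpair.2 n.unpair.2 with hlt | heq | hlt
      · exact absurd (hmn ▸ hm.1 : q (n.unpair.1, m.unpair.2)) (hn.2 _ hlt)
      · exact heq
      · exact absurd (hmn ▸ hn.1 : q (m.unpair.1, n.unpair.2)) (hm.2 _ hlt)
    rw [← Nat.pair_unpair m, ← Nat.pair_unpair n, hmn, this]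
  have hUinf : {n | U n}.Infinite := by
    intro hfin
    refine hinf ((hfin.image fun n => n.unpair.1).subset fun w hw => ?_)
    obtain ⟨n, hn, rfl⟩ := hex w hw
    exact ⟨n, hn, rfl⟩
  have hmem := fun n => Nat.nth_mem_of_infinite hUinf n
  have hg : Computable fun n => (Nat.nth U n).unpair.1 :=
    Computable.fst.comp (Computable.unpair.comp (computable_nth hU hUinf))
  let κ : ℕ → K.Suborder W :=
    fun n => ⟨K.elem (Nat.nth U n).unpair.1, _, hUW _ (hmem n), rfl⟩
  have hκ : Function.Injective κ := fun m n hmn =>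
    Nat.nth_injective hUinf (hinj _ _ (hmem m) (hmem n) (Subtype.ext_iff.1 hmn))
  have hsurj : Function.Surjective κ := by
    rintro ⟨_, w, hw, rfl⟩
    obtain ⟨n, hn, rfl⟩ := hex w hw
    obtain ⟨k, -, hk⟩ := Nat.exists_lt_card_nth_eq hn
    exact ⟨k, Subtype.ext (by simp only [κ, hk])⟩
  refine ⟨ofInjective κ hκ (K.computablePred_lt (hg.comp Computable.fst)
    (hg.comp Computable.snd)), ⟨⟨Equiv.ofBijective κ ⟨hκ, hsurj⟩, ?_⟩⟩⟩
  exact Iff.rfl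

/-- The lexicographic product of two computable linear orders, on the codes of pairs. -/
def lex (E F : ComputableLinearOrder) : ComputableLinearOrder :=
  ofInjective (fun n => toLex (E.elem n.unpair.1, F.elem n.unpair.2))
    (fun m n h => by
      have h' := toLex_inj.1 h
      rw [Prod.mk.injEq] at h'
      rw [← Nat.pair_unpair m, ← Nat.pair_unpair n, E.elem_injective h'.1,
        F.elem_injective h'.2])
    (by
      have h1 : Computable fun p : ℕ × ℕ => p.1.unpair.1 :=
        Computable.fst.comp (Computable.unpair.comp Computable.fst)
      have h2 : Computable fun p : ℕ × ℕ => p.1.unpair.2 :=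
        Computable.snd.comp (Computable.unpair.comp Computable.fst)
      have h3 : Computable fun p : ℕ × ℕ => p.2.unpair.1 :=
        Computable.fst.comp (Computable.unpair.comp Computable.snd)
      have h4 : Computable fun p : ℕ × ℕ => p.2.unpair.2 :=
        Computable.snd.comp (Computable.unpair.comp Computable.snd)
      refine isSigma_zero.1 (((isSigma_zero.2 (E.computablePred_lt h1 h3)).or
        ((isSigma_zero.2 (computablePred_natEq h1 h3)).and
          (isSigma_zero.2 (F.computablePred_lt h2 h4)))).congr fun p => ?_)
      rw [Prod.Lex.toLex_lt_toLex]
      simp)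

theorem lex_lt {E F : ComputableLinearOrder} {a b c d : ℕ} :
    (E.lex F).elem (Nat.pair a b) < (E.lex F).elem (Nat.pair c d) ↔
      E.elem a < E.elem c ∨ a = c ∧ F.elem b < F.elem d := by
  refine ofInjective_lt.trans ?_
  rw [Prod.Lex.toLex_lt_toLex]
  simp

/-- The order-type `ω`. -/
def omega : ComputableLinearOrder :=
  ofInjective id Function.injective_id (computablePred_natLt Computable.fst Computable.snd)

theorem omega_lt {m n : ℕ} : omega.elem m < omega.elem n ↔ m < n := Iff.rfl

/-- The order-type `ω*`. -/
def omegaStar : ComputableLinearOrder :=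
  ofInjective (OrderDual.toDual : ℕ → ℕᵒᵈ) OrderDual.toDual.injective
    (computablePred_natLt Computable.snd Computable.fst)

theorem omegaStar_lt {m n : ℕ} : omegaStar.elem m < omegaStar.elem n ↔ n < m := Iff.rfl

theorem computablePred_ratio_lt {a b c : ℕ → ℕ} (ha : Computable a) (hb : Computable b)
    (hc : Computable c) (h0 : ∀ n, 0 < c n) :
    ComputablePred fun p : ℕ × ℕ =>
      ((a p.1 : ℚ) - b p.1) / c p.1 < ((a p.2 : ℚ) - b p.2) / c p.2 := by
  have hmul := Primrec.nat_mul.to_comp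
  have hadd := Primrec.nat_add.to_comp
  have h1 {f : ℕ → ℕ} (hf : Computable f) : Computable fun p : ℕ × ℕ => f p.1 :=
    hf.comp Computable.fst
  have h2 {f : ℕ → ℕ} (hf : Computable f) : Computable fun p : ℕ × ℕ => f p.2 :=
    hf.comp Computable.snd
  refine (computablePred_natLt (hadd.comp (hmul.comp (h1 ha) (h2 hc)) (hmul.comp (h2 hb) (h1 hc)))
    (hadd.comp (hmul.comp (h2 ha) (h1 hc)) (hmul.comp (h1 hb) (h2 hc)))).of_eq fun p => ?_
  have hc1 : (0 : ℚ) < c p.1 := by exact_mod_cast h0 _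
  have hc2 : (0 : ℚ) < c p.2 := by exact_mod_cast h0 _
  rw [div_lt_div_iff₀ hc1 hc2, ← @Nat.cast_lt ℚ]
  push_cast
  constructor <;> intro h <;> linarith

/-- The numbering `2t ↦ t`, `2t + 1 ↦ -(t + 1)` of the integers. -/
def intOf (n : ℕ) : ℤ := if n % 2 = 0 then (n / 2 : ℕ) else -((n / 2 : ℕ) + 1)

theorem intOf_even (t : ℕ) : intOf (2 * t) = t := by
  simp [intOf]

theorem intOf_odd (t : ℕ) : intOf (2 * t + 1) = -(t + 1) := by
  simp [intOf, Nat.add_mod]; omega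

theorem intOf_bijective : Function.Bijective intOf := by
  constructor
  · intro m n h
    unfold intOf at h
    split_ifs at h <;> omega
  · intro z
    rcases z with t | t
    · exact ⟨2 * t, intOf_even t⟩
    · exact ⟨2 * t + 1, by rw [intOf_odd, Int.negSucc_eq]⟩

/-- The order-type `ω* + ω`. -/
def zeta : ComputableLinearOrder :=
  ofInjective intOf intOf_bijective.1 (by
    have hd : Computable fun n : ℕ => n / 2 :=
      Primrec.nat_div.to_comp.comp Computable.id (Computable.const 2)
    have hm : Computable fun n : ℕ => n % 2 :=
      Primrec.nat_mod.to_comp.comp Computable.id (Computable.const 2)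
    refine (computablePred_ratio_lt (a := fun n => (n / 2) * (1 - n % 2))
      (b := fun n => (n / 2 + 1) * (n % 2)) (c := fun _ => 1) ?_ ?_ (Computable.const 1)
      (fun _ => one_pos)).of_eq fun p => ?_
    · exact Primrec.nat_mul.to_comp.comp hd (Primrec.nat_sub.to_comp.comp (Computable.const 1) hm)
    · exact Primrec.nat_mul.to_comp.comp (Computable.succ.comp hd) hm
    · have key : ∀ n : ℕ, ((((n / 2) * (1 - n % 2) : ℕ) : ℚ) - ((n / 2 + 1) * (n % 2) : ℕ)) /
          ((1 : ℕ) : ℚ) = (intOf n : ℤ) := by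
        intro n
        unfold intOf
        generalize n / 2 = k
        rcases Nat.mod_two_eq_zero_or_one n with h | h <;> simp [h]
      rw [key, key, Int.cast_lt])

/-- The rational numbers `0`, `1 / (2t + 2)` and `-1 / (2t + 3)`, numbered by `0`, `2t + 1`
and `2t + 2`. -/
def centreVal (n : ℕ) : ℚ := (((n % 2 : ℕ) : ℚ) - (min n 1 - n % 2 : ℕ)) / (n + 1 : ℕ)

theorem centreVal_zero : centreVal 0 = 0 := by simp [centreVal]

theorem centreVal_right (t : ℕ) : centreVal (2 * t + 1) = 1 / (2 * t + 2) := by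
  have : (2 * t + 1) % 2 = 1 := by omega
  simp [centreVal, this]; ring

theorem centreVal_left (t : ℕ) : centreVal (2 * t + 2) = -(1 / (2 * t + 3)) := by
  have : (2 * t + 2) % 2 = 0 := by omega
  simp [centreVal, this]; ring

theorem centre_cases (n : ℕ) : n = 0 ∨ (∃ t, n = 2 * t + 1) ∨ ∃ t, n = 2 * t + 2 := by
  rcases Nat.even_or_odd' n with ⟨k, rfl | rfl⟩
  · rcases k with _ | k
    · exact Or.inl rfl
    · exact Or.inr (Or.inr ⟨k, by ring⟩)
  · exact Or.inr (Or.inl ⟨k, rfl⟩)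

theorem centreVal_right_pos (t : ℕ) : 0 < centreVal (2 * t + 1) := by
  rw [centreVal_right]; positivity

theorem centreVal_left_neg (t : ℕ) : centreVal (2 * t + 2) < 0 := by
  rw [centreVal_left, neg_lt_zero]; positivity

theorem centreVal_right_lt {s t : ℕ} : centreVal (2 * s + 1) < centreVal (2 * t + 1) ↔ t < s := by
  rw [centreVal_right, centreVal_right, one_div_lt_one_div (by positivity) (by positivity),
    ← @Nat.cast_lt ℚ]
  constructor <;> intro h <;> linarith

theorem centreVal_left_lt {s t : ℕ} : centreVal (2 * s + 2) < centreVal (2 * t + 2) ↔ s < t := by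
  rw [centreVal_left, centreVal_left, neg_lt_neg_iff,
    one_div_lt_one_div (by positivity) (by positivity), ← @Nat.cast_lt ℚ]
  constructor <;> intro h <;> linarith

theorem centreVal_injective : Function.Injective centreVal := by
  intro m n h
  rcases centre_cases m with rfl | ⟨s, rfl⟩ | ⟨s, rfl⟩ <;>
    rcases centre_cases n with rfl | ⟨t, rfl⟩ | ⟨t, rfl⟩
  · rfl
  · linarith [centreVal_zero, centreVal_right_pos t]
  · linarith [centreVal_zero, centreVal_left_neg t]
  · linarith [centreVal_zero, centreVal_right_pos s]
  · have h1 := mt centreVal_right_lt.2 h.not_lt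
    have h2 := mt centreVal_right_lt.2 h.symm.not_lt
    omega
  · linarith [centreVal_right_pos s, centreVal_left_neg t]
  · linarith [centreVal_zero, centreVal_left_neg s]
  · linarith [centreVal_right_pos t, centreVal_left_neg s]
  · have h1 := mt centreVal_left_lt.2 h.not_lt
    have h2 := mt centreVal_left_lt.2 h.symm.not_lt
    omega

/-- The order-type `ω + 1 + ω*`: the number `0` is the centre, the numbers `2t + 2` increase to it
and the numbers `2t + 1` decrease to it. -/
def centre : ComputableLinearOrder :=
  ofInjective centreVal centreVal_injective (by
    have hm : Computable fun n : ℕ => n % 2 :=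
      Primrec.nat_mod.to_comp.comp Computable.id (Computable.const 2)
    exact computablePred_ratio_lt (a := fun n => n % 2) (b := fun n => min n 1 - n % 2)
      (c := fun n => n + 1) hm (Primrec.nat_sub.to_comp.comp
        (Primrec.nat_min.to_comp.comp Computable.id (Computable.const 1)) hm)
      Computable.succ (fun _ => Nat.succ_pos _))

theorem centre_zero_lt_right (t : ℕ) : centre.elem 0 < centre.elem (2 * t + 1) :=
  ofInjective_lt.2 (centreVal_zero ▸ centreVal_right_pos t)

theorem centre_left_lt_zero (t : ℕ) : centre.elem (2 * t + 2) < centre.elem 0 :=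
  ofInjective_lt.2 (centreVal_zero ▸ centreVal_left_neg t)

theorem centre_left_lt_right (s t : ℕ) : centre.elem (2 * s + 2) < centre.elem (2 * t + 1) :=
  (centre_left_lt_zero s).trans (centre_zero_lt_right t)

theorem centre_right_lt_right {s t : ℕ} :
    centre.elem (2 * s + 1) < centre.elem (2 * t + 1) ↔ t < s :=
  ofInjective_lt.trans centreVal_right_lt

theorem centre_left_lt_left {s t : ℕ} :
    centre.elem (2 * s + 2) < centre.elem (2 * t + 2) ↔ s < t :=
  ofInjective_lt.trans centreVal_left_lt

/-- The positive dyadic rational `(2a + 1) / 2 ^ b`, where `n` codes the pair `(a, b)`. -/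
def dyadicVal (n : ℕ) : ℚ :=
  (((2 * n.unpair.1 + 1 : ℕ) : ℚ) - (0 : ℕ)) / (2 ^ n.unpair.2 : ℕ)

theorem dyadicVal_pair (a b : ℕ) : dyadicVal (Nat.pair a b) = (2 * a + 1) / 2 ^ b := by
  simp [dyadicVal]

theorem dyadicVal_injective : Function.Injective dyadicVal := by
  intro m n h
  rw [← Nat.pair_unpair m, ← Nat.pair_unpair n] at h ⊢
  generalize m.unpair.1 = a at *
  generalize m.unpair.2 = b at *
  generalize n.unpair.1 = c at *
  generalize n.unpair.2 = d at *
  rw [dyadicVal_pair, dyadicVal_pair, div_eq_div_iff (by positivity) (by positivity)] at h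
  have h' : (2 * a + 1) * 2 ^ d = (2 * c + 1) * 2 ^ b := by exact_mod_cast h
  have aux : ∀ a b c d : ℕ, (2 * a + 1) * 2 ^ d = (2 * c + 1) * 2 ^ b → d ≤ b := by
    intro a b c d h
    have h1 : 2 ^ d ∣ 2 ^ b := by
      refine Nat.Coprime.dvd_of_dvd_mul_left (k := 2 ^ d) (m := 2 * c + 1) ?_
        ⟨2 * a + 1, ?_⟩
      · exact Nat.Coprime.pow_left _ (by simp)
      · rw [← h]; ring
    exact (Nat.pow_dvd_pow_iff_le_right (by norm_num)).1 h1
  have hbd : b = d := le_antisymm (aux _ _ _ _ h'.symm) (aux _ _ _ _ h')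
  subst hbd
  have := Nat.eq_of_mul_eq_mul_right (by positivity) h'
  rw [show a = c by omega]

/-- A computable linear order of type `η`, realised by positive dyadic rationals. -/
def eta : ComputableLinearOrder :=
  ofInjective dyadicVal dyadicVal_injective (by
    have h1 : Computable fun n : ℕ => n.unpair.1 := Computable.fst.comp Computable.unpair
    have h2 : Computable fun n : ℕ => n.unpair.2 := Computable.snd.comp Computable.unpair
    have hpow : Primrec fun n : ℕ => 2 ^ n := by
      refine (Primrec.nat_rec₁ (f := fun _ b => 2 * b) 1
        (Primrec.nat_mul.comp (Primrec.const 2) Primrec.snd)).of_eq fun n => ?_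
      induction n with
      | zero => rfl
      | succ n ih => rw [pow_succ, ← ih]; ring
    exact computablePred_ratio_lt (a := fun n => 2 * n.unpair.1 + 1) (b := fun _ => 0)
      (c := fun n => 2 ^ n.unpair.2)
      (Computable.succ.comp (Primrec.nat_mul.to_comp.comp (Computable.const 2) h1))
      (Computable.const 0) (hpow.to_comp.comp h2) (fun _ => by positivity))

theorem exists_dyadicVal_between {x y : ℚ} (hx : 0 ≤ x) (hxy : x < y) :
    ∃ n, x < dyadicVal n ∧ dyadicVal n < y := by
  obtain ⟨b, hb⟩ := pow_unbounded_of_one_lt (2 / (y - x)) (one_lt_two (α := ℚ))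
  have hpos : (0 : ℚ) < 2 ^ b := by positivity
  have hb' : 2 < 2 ^ b * (y - x) := by
    rwa [div_lt_iff₀ (by linarith)] at hb
  -- The least odd numerator `2a + 1` above `2 ^ b * x` is at most `2 ^ b * x + 2`.
  let a := ⌊(2 ^ b * x + 1) / 2⌋₊
  have h1 : (a : ℚ) ≤ (2 ^ b * x + 1) / 2 := Nat.floor_le (by positivity)
  have h2 : (2 ^ b * x + 1) / 2 < a + 1 := Nat.lt_floor_add_one _
  refine ⟨Nat.pair a b, ?_, ?_⟩
  · rw [dyadicVal_pair, lt_div_iff₀ hpos]; nlinarith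
  · rw [dyadicVal_pair, div_lt_iff₀ hpos]; nlinarith

theorem dyadicVal_pos (n : ℕ) : 0 < dyadicVal n := by
  rw [← Nat.pair_unpair n, dyadicVal_pair]; positivity

instance : DenselyOrdered eta where
  dense x y hxy := by
    obtain ⟨n, h1, h2⟩ := exists_dyadicVal_between (dyadicVal_pos _).le hxy
    exact ⟨eta.elem n, h1, h2⟩

instance : NoMinOrder eta where
  exists_lt x := by
    obtain ⟨n, -, h2⟩ := exists_dyadicVal_between le_rfl (dyadicVal_pos (num x))
    exact ⟨eta.elem n, h2⟩

instance : NoMaxOrder eta where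
  exists_gt x := by
    obtain ⟨n, h1, -⟩ := exists_dyadicVal_between (dyadicVal_pos (num x)).le (lt_add_one _)
    exact ⟨eta.elem n, h1⟩

end ComputableLinearOrder

/-! ### Blocks of a prime block replacement -/

section Replacement

open ComputableLinearOrder

variable {L M E : ComputableLinearOrder} {A : Set ℕ}

theorem isPrimeBlockReplacement_of_orderIso {α : Type*} [LinearOrder α] (g : L ≃o α) {f : α → E}
    (hf : Monotone f)
    (h1 : ∀ n ∈ A, Nonempty ({x : α // f x = E.elem n} ≃o Fin (Nat.nth Nat.Prime n)))
    (h2 : ∀ n ∉ A, Nonempty ({x : α // f x = E.elem n} ≃o ℤ)) :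
    IsPrimeBlockReplacement L E A := by
  have key : ∀ e : E, Nonempty ({x : L // f (g x) = e} ≃o {x : α // f x = e}) := fun e =>
    ⟨⟨g.toEquiv.subtypeEquiv fun _ => Iff.rfl, fun {a b} => g.le_iff_le (x := a.1) (y := b.1)⟩⟩
  refine ⟨f ∘ g, hf.comp g.monotone, fun n hn => ?_, fun n hn => ?_⟩
  · exact ⟨(key _).some.trans (h1 n hn).some⟩
  · exact ⟨(key _).some.trans (h2 n hn).some⟩

theorem IsPrimeBlockReplacement.of_orderIso (h : IsPrimeBlockReplacement L E A) (g : M ≃o L) :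
    IsPrimeBlockReplacement M E A := by
  obtain ⟨f, hf, h1, h2⟩ := h
  exact isPrimeBlockReplacement_of_orderIso g hf h1 h2

/-- If the fibres of a monotone surjection to a densely ordered set are locally finite, then they
are the blocks. -/
theorem blockRel_iff_of_monotone {α β : Type*} [LinearOrder α] [LinearOrder β] [DenselyOrdered β]
    {f : α → β} (hf : Monotone f) (hs : Function.Surjective f)
    (hfib : ∀ (b : β) (x y : {x : α // f x = b}), (Set.Icc x y).Finite) {x y : α} :
    BlockRel x y ↔ f x = f y := by
  wlog hxy : x ≤ y generalizing x y
  · rw [eq_comm, ← this (le_of_not_ge hxy)]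
    exact ⟨(blockRel_equivalence α).symm, (blockRel_equivalence α).symm⟩
  rw [BlockRel, Set.uIcc_of_le hxy]
  constructor
  · intro hfin
    by_contra hne
    have hlt : f x < f y := lt_of_le_of_ne (hf hxy) hne
    refine Set.Ioo_infinite hlt ((hfin.image f).subset fun b hb => ?_)
    obtain ⟨z, rfl⟩ := hs b
    exact ⟨z, ⟨(hf.reflect_lt hb.1).le, (hf.reflect_lt hb.2).le⟩, rfl⟩
  · intro heq
    refine ((hfib (f x) ⟨x, rfl⟩ ⟨y, heq.symm⟩).image Subtype.val).subset fun z hz => ?_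
    refine ⟨⟨z, le_antisymm ((hf hz.2).trans heq.ge) (hf hz.1)⟩, ⟨hz.1, hz.2⟩, rfl⟩

/-- The condensation of an order whose blocks are the fibres of a monotone surjection. -/
theorem nonempty_condensation_orderIso {α β : Type*} [LinearOrder α] [LinearOrder β]
    {f : α → β} (hf : Monotone f) (hs : Function.Surjective f)
    (hB : ∀ x y, BlockRel x y ↔ f x = f y) : Nonempty (Condensation α ≃o β) := by
  let F : Condensation α → β := Quotient.lift f fun x y h => (hB x y).1 h
  have hF : ∀ x, F (toCondensation x) = f x := fun _ => rfl
  have hmono : Monotone F := by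
    rintro a b ⟨x, y, rfl, rfl, hxy⟩
    exact hf hxy
  have hinj : Function.Injective F := by
    intro a b
    obtain ⟨x, rfl⟩ := Quotient.exists_rep a
    obtain ⟨y, rfl⟩ := Quotient.exists_rep b
    exact fun h => toCondensation_eq_iff.2 ((hB x y).2 h)
  exact ⟨(hmono.strictMono_of_injective hinj).orderIsoOfSurjective F
    fun b => (hs b).imp' toCondensation fun x hx => hx⟩

variable {f : L → E}

theorem fibre_finite_Icc
    (h1 : ∀ n ∈ A, Nonempty ({x : L // f x = E.elem n} ≃o Fin (Nat.nth Nat.Prime n)))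
    (h2 : ∀ n ∉ A, Nonempty ({x : L // f x = E.elem n} ≃o ℤ)) (e : E) (x y : {x : L // f x = e}) :
    (Set.Icc x y).Finite := by
  by_cases he : num e ∈ A
  · obtain ⟨g⟩ := h1 _ he
    exact ((Set.finite_Icc (g x) (g y)).preimage g.injective.injOn).subset
      fun z hz => ⟨g.monotone hz.1, g.monotone hz.2⟩
  · obtain ⟨g⟩ := h2 _ he
    exact ((Set.finite_Icc (g x) (g y)).preimage g.injective.injOn).subset
      fun z hz => ⟨g.monotone hz.1, g.monotone hz.2⟩

theorem surjective_of_fibres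
    (h1 : ∀ n ∈ A, Nonempty ({x : L // f x = E.elem n} ≃o Fin (Nat.nth Nat.Prime n)))
    (h2 : ∀ n ∉ A, Nonempty ({x : L // f x = E.elem n} ≃o ℤ)) : Function.Surjective f := by
  intro e
  by_cases he : num e ∈ A
  · obtain ⟨g⟩ := h1 _ he
    obtain ⟨x, hx⟩ := g.symm ⟨0, (Nat.prime_nth_prime _).pos⟩
    exact ⟨x, hx⟩
  · obtain ⟨g⟩ := h2 _ he
    obtain ⟨x, hx⟩ := g.symm 0
    exact ⟨x, hx⟩

theorem IsPrimeBlockReplacement.hasCondensationTypeEta (h : IsPrimeBlockReplacement L E A)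
    (hE : Nonempty (E ≃o ℚ)) : HasCondensationTypeEta L := by
  obtain ⟨f, hf, h1, h2⟩ := h
  obtain ⟨e⟩ := hE
  have : DenselyOrdered E := (denselyOrdered_iff_of_orderIsoClass e.symm).1 inferInstance
  have hs := surjective_of_fibres h1 h2
  obtain ⟨c⟩ := nonempty_condensation_orderIso hf hs fun x y =>
    blockRel_iff_of_monotone hf hs (fibre_finite_Icc h1 h2)
  exact ⟨c.trans e⟩

theorem blockRel_coe_iff {α : Type*} [LinearOrder α] {I : Set α} (hI : I.OrdConnected) {x y : I} :
    BlockRel x y ↔ BlockRel (x : α) (y : α) := by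
  have h : Subtype.val '' Set.uIcc x y = Set.uIcc (x : α) (y : α) := by
    ext z
    constructor
    · rintro ⟨w, hw, rfl⟩
      rw [Set.mem_uIcc] at hw ⊢
      exact hw
    · intro hz
      refine ⟨⟨z, hI.uIcc_subset x.2 y.2 hz⟩, ?_, rfl⟩
      rw [Set.mem_uIcc] at hz ⊢
      exact hz
  rw [BlockRel, BlockRel, ← h, Set.finite_image_iff Subtype.val_injective.injOn]

/-- An interval that meets two blocks contains blocks of every large prime size. -/
theorem IsPrimeBlockReplacement.not_stronglyEtaLike (h : IsPrimeBlockReplacement L E A)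
    (hE : Nonempty (E ≃o ℚ)) {I : Set L} (hI : I.OrdConnected) : ¬ StronglyEtaLike I := by
  obtain ⟨f, hf, h1, h2⟩ := h
  obtain ⟨e⟩ := hE
  have : DenselyOrdered E := (denselyOrdered_iff_of_orderIsoClass e.symm).1 inferInstance
  have hs := surjective_of_fibres h1 h2
  have hB := fun x y : L =>
    blockRel_iff_of_monotone hf hs (fibre_finite_Icc h1 h2) (x := x) (y := y)
  rintro ⟨⟨c⟩, k, hk⟩
  obtain ⟨x, hx⟩ := Quotient.exists_rep (c.symm 0)
  obtain ⟨y, hy⟩ := Quotient.exists_rep (c.symm 1)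
  have hxy : ¬ f x = f y := by
    rw [← hB, ← blockRel_coe_iff hI, ← toCondensation_eq_iff]
    intro h
    have : c.symm 0 = c.symm 1 := hx.symm.trans (Eq.trans h hy)
    simp at this
  obtain ⟨x, y, hlt⟩ : ∃ x y : I, f x < f y := by
    rcases lt_or_gt_of_ne hxy with h | h
    · exact ⟨_, _, h⟩
    · exact ⟨_, _, h⟩
  -- Infinitely many labels occur between the two blocks, so one of them is at least `k`.
  obtain ⟨n, hn, hkn⟩ : ∃ n : ℕ, E.elem n ∈ Set.Ioo (f x) (f y) ∧ k ≤ n := by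
    by_contra hcon
    push Not at hcon
    exact Set.Ioo_infinite hlt (((Set.finite_Iio k).image E.elem).subset
      fun z hz => ⟨num z, hcon _ hz, rfl⟩)
  obtain ⟨g, hg⟩ : ∃ g : Fin k → {x : L // f x = E.elem n}, Function.Injective g := by
    by_cases hnA : n ∈ A
    · obtain ⟨g⟩ := h1 n hnA
      have hle : k ≤ Nat.nth Nat.Prime n :=
        hkn.trans ((Nat.le_add_right n 2).trans (Nat.add_two_le_nth_prime n))
      exact ⟨g.symm ∘ Fin.castLE hle, g.symm.injective.comp (Fin.castLE_injective hle)⟩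
    · obtain ⟨g⟩ := h2 n hnA
      exact ⟨fun i => g.symm (i : ℕ), fun i j hij =>
        Fin.ext (by exact_mod_cast g.symm.injective hij)⟩
  have hmem : ∀ z, f z = E.elem n → z ∈ I := fun z hz =>
    hI.out x.2 y.2 ⟨(hf.reflect_lt (hz ▸ hn.1)).le, (hf.reflect_lt (hz ▸ hn.2)).le⟩
  obtain ⟨z, hz⟩ := hs (E.elem n)
  refine absurd (hk ⟨z, hmem z hz⟩) (not_lt.2 ?_)
  let g' : Fin k → I := fun i => ⟨g i, hmem _ (g i).2⟩
  have hg' : Function.Injective g' := fun i j hij =>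
    hg (Subtype.ext (congrArg (Subtype.val : I → L) hij))
  calc (k : ℕ∞) = (Set.range g').encard := by
        rw [← Set.image_univ, hg'.encard_image, Set.encard_univ, ENat.card_eq_coe_fintype_card,
          Fintype.card_fin]
    _ ≤ _ := Set.encard_le_encard (by
        rintro _ ⟨i, rfl⟩
        exact (blockRel_coe_iff hI).2 ((hB _ _).2 (hz.trans (g i).2.symm)))

/-- If the block relation is c.e., then the left ends of the blocks form a `Π₁` set; a block has
a left end exactly when it is finite, so this set is a copy of the suborder `A`. -/
theorem IsPrimeBlockReplacement.hasPi1Copy (h : IsPrimeBlockReplacement L E A)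
    (hE : Nonempty (E ≃o ℚ)) (hB : L.HasCEBlockRel) : HasPi1Copy (E.Suborder A) := by
  obtain ⟨f, hf, h1, h2⟩ := h
  obtain ⟨e⟩ := hE
  have : DenselyOrdered E := (denselyOrdered_iff_of_orderIsoClass e.symm).1 inferInstance
  have hs := surjective_of_fibres h1 h2
  have hBf := fun x y : L =>
    blockRel_iff_of_monotone hf hs (fibre_finite_Icc h1 h2) (x := x) (y := y)
  let P : Set ℕ := {n | ∀ m, L.elem m < L.elem n → ¬ BlockRel (L.elem m) (L.elem n)}
  have hP : IsPi 1 fun n => n ∈ P := by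
    have hlt : ComputablePred fun p : ℕ × ℕ => L.elem p.2 < L.elem p.1 :=
      L.computablePred_lt Computable.snd Computable.fst
    have hb : IsSigma 1 fun p : ℕ × ℕ => BlockRel (L.elem p.2) (L.elem p.1) :=
      (IsSigma.of_rePred hB).comp (Computable.snd.pair Computable.fst)
    exact (IsPi.imp (IsSigma.of_computablePred (k := 1) hlt) hb.not).forall
  have hPmem : ∀ x : L, num x ∈ P ↔ ∀ y < x, f y ≠ f x := fun x =>
    forall_congr' fun m => imp_congr_right fun _ => not_congr (hBf (L.elem m) x)
  have hPA : ∀ x : L, num x ∈ P → num (f x) ∈ A := by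
    intro x hx
    by_contra hA
    obtain ⟨g⟩ := h2 _ hA
    let x' : {y : L // f y = E.elem (num (f x))} := ⟨x, rfl⟩
    have hlt : g.symm (g x' - 1) < x' := by
      rw [← g.lt_iff_lt, g.apply_symm_apply]; omega
    exact (hPmem x).1 hx _ hlt (g.symm (g x' - 1)).2
  let F : L.Suborder P → E.Suborder A := fun x =>
    ⟨f x.1, num (f x.1), hPA _ (by obtain ⟨_, n, hn, rfl⟩ := x; exact hn), rfl⟩
  have hinj : ∀ x y : L.Suborder P, x < y → f x ≠ f y := by
    rintro x ⟨_, n, hn, rfl⟩ hxy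
    exact (hPmem _).1 hn x.1 hxy
  have hF : StrictMono F := fun x y hxy =>
    lt_of_le_of_ne (hf hxy.le) fun h => hinj x y hxy (congrArg Subtype.val h)
  have hFs : Function.Surjective F := by
    rintro ⟨_, n, hn, rfl⟩
    obtain ⟨g⟩ := h1 n hn
    have : NeZero (Nat.nth Nat.Prime n) := ⟨(Nat.prime_nth_prime n).ne_zero⟩
    have hmin : ∀ y, g.symm 0 ≤ y := fun y => by
      rw [← g.le_iff_le, g.apply_symm_apply]; exact Fin.zero_le _
    refine ⟨⟨(g.symm 0).1, num (g.symm 0).1, (hPmem _).2 fun y hy hfy => ?_, rfl⟩,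
      Subtype.ext (g.symm 0).2⟩
    exact absurd hy (not_lt.2 (hmin ⟨y, hfy.trans (g.symm 0).2⟩))
  exact ⟨L, P, isPi1_iff.2 hP, ⟨hF.orderIsoOfSurjective F hFs⟩⟩

end Replacement

namespace ComputableLinearOrder

/-! ### Coordinates in lexicographic products -/

section Lex

variable {E F : ComputableLinearOrder}

/-- The point of the lexicographic product with the given coordinates. -/
def lexMk (a : E) (b : F) : E.lex F := (E.lex F).elem (Nat.pair (num a) (num b))

/-- The first coordinate of a point of a lexicographic product. -/
def lexFst (x : E.lex F) : E := E.elem (num x).unpair.1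

/-- The second coordinate of a point of a lexicographic product. -/
def lexSnd (x : E.lex F) : F := F.elem (num x).unpair.2

@[simp] theorem lexFst_mk (a : E) (b : F) : lexFst (lexMk a b) = a := by
  simp [lexFst, lexMk]

@[simp] theorem lexSnd_mk (a : E) (b : F) : lexSnd (lexMk a b) = b := by
  simp [lexSnd, lexMk]

@[simp] theorem lexMk_eta (x : E.lex F) : lexMk (lexFst x) (lexSnd x) = x := by
  simp [lexFst, lexSnd, lexMk]

theorem lex_ext {x y : E.lex F} (h1 : lexFst x = lexFst y) (h2 : lexSnd x = lexSnd y) : x = y := by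
  rw [← lexMk_eta x, ← lexMk_eta y, h1, h2]

theorem lex_lt_iff {x y : E.lex F} :
    x < y ↔ lexFst x < lexFst y ∨ lexFst x = lexFst y ∧ lexSnd x < lexSnd y := by
  conv_lhs => rw [← lexMk_eta x, ← lexMk_eta y]
  exact lex_lt

theorem lexFst_mono : Monotone (lexFst : E.lex F → E) := fun x y hxy => by
  rcases hxy.eq_or_lt with rfl | h
  · exact le_rfl
  · exact (lex_lt_iff.1 h).elim le_of_lt fun h => h.1.le

theorem lex_le_iff {x y : E.lex F} :
    x ≤ y ↔ lexFst x < lexFst y ∨ lexFst x = lexFst y ∧ lexSnd x ≤ lexSnd y := by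
  rw [le_iff_eq_or_lt, lex_lt_iff, le_iff_eq_or_lt]
  constructor
  · rintro (rfl | h | h)
    · exact Or.inr ⟨rfl, Or.inl rfl⟩
    · exact Or.inl h
    · exact Or.inr ⟨h.1, Or.inr h.2⟩
  · rintro (h | ⟨h1, h2 | h2⟩)
    · exact Or.inr (Or.inl h)
    · exact Or.inl (lex_ext h1 h2)
    · exact Or.inr (Or.inr ⟨h1, h2⟩)

theorem lexMk_lt_iff {a c : E} {b d : F} : lexMk a b < lexMk c d ↔ a < c ∨ a = c ∧ b < d := by
  rw [lex_lt_iff]; simp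

theorem lt_lexMk_iff {x : E.lex F} {c : E} {d : F} :
    x < lexMk c d ↔ lexFst x < c ∨ lexFst x = c ∧ lexSnd x < d := by
  rw [lex_lt_iff]; simp

theorem mk_lt_iff {x : E.lex F} {c : E} {d : F} :
    lexMk c d < x ↔ c < lexFst x ∨ c = lexFst x ∧ d < lexSnd x := by
  rw [lex_lt_iff]; simp

theorem exists_lt_and_lexFst_eq [NoMinOrder F] (x : E.lex F) :
    ∃ y, y < x ∧ lexFst y = lexFst x := by
  obtain ⟨b, hb⟩ := exists_lt (lexSnd x)
  exact ⟨lexMk (lexFst x) b, mk_lt_iff.2 (Or.inr ⟨rfl, hb⟩), by simp⟩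

theorem exists_gt_and_lexFst_eq [NoMaxOrder F] (x : E.lex F) :
    ∃ y, x < y ∧ lexFst y = lexFst x := by
  obtain ⟨b, hb⟩ := exists_gt (lexSnd x)
  exact ⟨lexMk (lexFst x) b, lt_lexMk_iff.2 (Or.inr ⟨rfl, hb⟩), by simp⟩

theorem exists_between_and_lexFst_eq [DenselyOrdered F] {x y : E.lex F}
    (hxy : x < y) (h : lexFst x = lexFst y) : ∃ z, x < z ∧ z < y ∧ lexFst z = lexFst x := by
  obtain ⟨b, hb⟩ := exists_between ((lex_lt_iff.1 hxy).resolve_left h.not_lt).2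
  exact ⟨lexMk (lexFst x) b, lt_lexMk_iff.2 (Or.inr ⟨rfl, hb.1⟩),
    mk_lt_iff.2 (Or.inr ⟨h, hb.2⟩), by simp⟩

instance [NoMinOrder F] : NoMinOrder (E.lex F) :=
  ⟨fun x => (exists_lt_and_lexFst_eq x).imp fun _ h => h.1⟩

instance [NoMaxOrder F] : NoMaxOrder (E.lex F) :=
  ⟨fun x => (exists_gt_and_lexFst_eq x).imp fun _ h => h.1⟩

instance [DenselyOrdered F] [NoMaxOrder F] : DenselyOrdered (E.lex F) where
  dense x y hxy := by
    by_cases h : lexFst x = lexFst y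
    · obtain ⟨z, h1, h2, -⟩ := exists_between_and_lexFst_eq hxy h
      exact ⟨z, h1, h2⟩
    · obtain ⟨z, h1, h2⟩ := exists_gt_and_lexFst_eq x
      exact ⟨z, h1, lex_lt_iff.2 (Or.inl (h2 ▸ lt_of_le_of_ne (lexFst_mono hxy.le) h))⟩

end Lex

theorem nonempty_lex_eta_orderIso (E : ComputableLinearOrder) : Nonempty (E.lex eta ≃o ℚ) :=
  have : Nonempty (E.lex eta) := ⟨elem _ 0⟩
  Order.iso_of_countable_dense _ _

/-- The suborder of `E.lex F` on the points of `A × {0}` is a copy of the suborder `A` of `E`. -/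
theorem nonempty_suborder_lex_orderIso (E F : ComputableLinearOrder) (A : Set ℕ) :
    Nonempty ((E.lex F).Suborder {n | ∃ i ∈ A, n = Nat.pair i 0} ≃o E.Suborder A) := by
  let g : E.Suborder A → (E.lex F).Suborder {n | ∃ i ∈ A, n = Nat.pair i 0} := fun x =>
    ⟨lexMk x.1 (F.elem 0), _, ⟨num x.1, by obtain ⟨_, n, hn, rfl⟩ := x; exact hn, rfl⟩, rfl⟩
  have hg : StrictMono g := fun x y hxy =>
    (lexMk_lt_iff.2 (Or.inl hxy) : lexMk x.1 (F.elem 0) < lexMk y.1 (F.elem 0))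
  refine ⟨(hg.orderIsoOfSurjective g ?_).symm⟩
  rintro ⟨_, _, ⟨i, hi, rfl⟩, rfl⟩
  exact ⟨⟨E.elem i, i, hi, rfl⟩, rfl⟩

end ComputableLinearOrder

theorem exists_orderIso_apply_eq {α β : Type*} [LinearOrder α] [LinearOrder β] [Countable α]
    [Countable β] [DenselyOrdered α] [DenselyOrdered β] [NoMinOrder α] [NoMinOrder β]
    [NoMaxOrder α] [NoMaxOrder β] (a : α) (b : β) : ∃ e : α ≃o β, e a = b := by
  have : Nonempty α := ⟨a⟩
  have : Nonempty β := ⟨b⟩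
  obtain ⟨f⟩ := Order.iso_of_countable_dense α ℚ
  obtain ⟨g⟩ := Order.iso_of_countable_dense ℚ β
  refine ⟨(f.trans (OrderIso.addRight (g.symm b - f a))).trans g, ?_⟩
  simp

/-! ### The computable replacement of the points of an order, along a `Π₂` set -/

/-- The `a`-th entry of the list with code `l`, or `0` if the list is too short. -/
def listEntry (l a : ℕ) : ℕ := (Denumerable.ofNat (List ℕ) l).getD a 0

theorem computable₂_listEntry : Computable₂ listEntry :=
  (Primrec.list_getD 0).to_comp.comp ((Computable.ofNat (List ℕ)).comp Computable.fst)
    Computable.snd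

theorem forall_lt_exists_iff {Q : ℕ → ℕ → Prop} {t : ℕ} :
    (∀ a < t, ∃ b, Q a b) ↔ ∃ l, ∀ a < t, Q a (listEntry l a) := by
  constructor
  · intro h
    choose! g hg using h
    refine ⟨Encodable.encode ((List.range t).map g), fun a ha => ?_⟩
    simpa [listEntry, ha] using hg a ha
  · rintro ⟨l, hl⟩ a ha
    exact ⟨_, hl a ha⟩

theorem IsSigma.forall_lt {α : Type} [Primcodable α] {p : α × ℕ → Prop} (hp : IsSigma 1 p) :
    IsSigma 1 fun x : α × ℕ => ∀ m < x.2, p (x.1, m) := by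
  obtain ⟨q, hq, h⟩ := hp
  have h0 : ComputablePred fun x : ((α × ℕ) × ℕ) × ℕ =>
      q ((x.1.1.1, x.2), listEntry x.1.2 x.2) :=
    (isPi_zero.1 hq).comp_computable
      (((Computable.fst.comp (Computable.fst.comp Computable.fst)).pair Computable.snd).pair
        (computable₂_listEntry.comp (Computable.snd.comp Computable.fst) Computable.snd))
  have h1 : ComputablePred fun x : (α × ℕ) × ℕ =>
      ∀ m < x.1.2, q ((x.1.1, m), listEntry x.2 m) :=
    h0.forall_lt.comp_computable (f := fun x : (α × ℕ) × ℕ => (x, x.1.2))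
      (Computable.id.pair (Computable.snd.comp Computable.fst))
  refine (isPi_zero.2 h1).exists.congr fun x => ?_
  simp only [h]
  exact forall_lt_exists_iff

/-- A `Π₂` set is the intersection of a decreasing, uniformly c.e. sequence of sets that starts
with `ℕ`. -/
theorem exists_antitone_approximation {A : Set ℕ} (hA : IsPi2 A) :
    ∃ G : ℕ → ℕ → Prop, (IsSigma 1 fun x : ℕ × ℕ => G x.1 x.2) ∧ (∀ i, G i 0) ∧
      (∀ i, Antitone (G i)) ∧ ∀ i, i ∈ A ↔ ∀ t, G i t := by
  obtain ⟨q, hq, h⟩ := isPi2_iff.1 hA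
  refine ⟨fun i t => ∀ a < t, ¬ q (i, a), IsSigma.forall_lt hq, by simp,
    fun i s t hst hs a ha => hs a (ha.trans_le hst), fun i => ?_⟩
  rw [← not_iff_not]
  refine (h i).trans ⟨fun ⟨n, hn⟩ h => h (n + 1) n n.lt_succ_self hn, fun h => ?_⟩
  push Not at h
  obtain ⟨_, n, -, hn⟩ := h
  exact ⟨n, hn⟩

namespace ComputableLinearOrder

section Construction

variable {G : ℕ → ℕ → Prop} {i : ℕ}

/-- The position `τ` around the `i`-th centre is released at its stage: the elements put there
do not belong to the block of the centre. The positions `2t + 1` and `2t + 2` have stage `t`. -/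
def Released (G : ℕ → ℕ → Prop) (i : ℕ) (τ : centre) : Prop :=
  0 < num τ ∧ G i ((num τ - 1) / 2)

theorem Released.lt_of_neg (hG : Antitone (G i)) {σ τ : centre} (hσ : Released G i σ)
    (hτ : ¬ Released G i τ) (h : σ < centre.elem 0) : σ < τ := by
  rcases centre_cases (num σ) with h0 | ⟨s, hs⟩ | ⟨s, hs⟩
  · exact absurd h (by rw [← elem_num σ, h0]; exact lt_irrefl _)
  · exact absurd (h.trans (centre_zero_lt_right s)) (by rw [← elem_num σ, hs]; exact lt_irrefl _)
  rcases centre_cases (num τ) with h0 | ⟨t, ht⟩ | ⟨t, ht⟩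
  · rwa [← elem_num τ, h0]
  · rw [← elem_num σ, ← elem_num τ, hs, ht]
    exact centre_left_lt_right s t
  · rw [← elem_num σ, ← elem_num τ, hs, ht, centre_left_lt_left]
    by_contra hlt
    refine hτ ⟨by omega, hG ?_ hσ.2⟩
    omega

theorem Released.lt_of_pos (hG : Antitone (G i)) {σ τ : centre} (hσ : Released G i σ)
    (hτ : ¬ Released G i τ) (h : centre.elem 0 < σ) : τ < σ := by
  rcases centre_cases (num σ) with h0 | ⟨s, hs⟩ | ⟨s, hs⟩
  · exact absurd h (by rw [← elem_num σ, h0]; exact lt_irrefl _)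
  swap
  · exact absurd (h.trans' (centre_left_lt_zero s)) (by rw [← elem_num σ, hs]; exact lt_irrefl _)
  rcases centre_cases (num τ) with h0 | ⟨t, ht⟩ | ⟨t, ht⟩
  · rwa [← elem_num τ, h0]
  · rw [← elem_num σ, ← elem_num τ, hs, ht, centre_right_lt_right]
    by_contra hlt
    refine hτ ⟨by omega, hG ?_ hσ.2⟩
    omega
  · rw [← elem_num σ, ← elem_num τ, hs, ht]
    exact centre_left_lt_right t s

theorem Released.ne_zero {τ : centre} (h : Released G i τ) : τ ≠ centre.elem 0 := by
  rintro rfl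
  exact lt_irrefl _ h.1

theorem released_one (h0 : G i 0) : Released G i (centre.elem 1) := ⟨one_pos, h0⟩

theorem released_two (h0 : G i 0) : Released G i (centre.elem 2) := ⟨two_pos, h0⟩

/-- The `i`-th centre. -/
def mid : centre.lex eta := lexMk (centre.elem 0) (eta.elem 0)

/-- The blocks around the `i`-th centre: the centre itself, and `η` many at each released
position. -/
abbrev Around (G : ℕ → ℕ → Prop) (i : ℕ) : Type :=
  {x : centre.lex eta // x = mid ∨ Released G i (lexFst x)}

theorem Around.dense_noEndpoints (h0 : G i 0) :
    DenselyOrdered (Around G i) ∧ NoMinOrder (Around G i) ∧ NoMaxOrder (Around G i) := by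
  refine ⟨⟨?_⟩, ⟨?_⟩, ⟨?_⟩⟩
  · rintro ⟨x, hx⟩ ⟨y, hy⟩ (hxy : x < y)
    rcases hx with rfl | hx
    · rcases hy with rfl | hy
      · exact absurd hxy (lt_irrefl _)
      · obtain ⟨z, h1, h2⟩ := exists_lt_and_lexFst_eq y
        refine ⟨⟨z, Or.inr (h2 ▸ hy)⟩, (lex_lt_iff.2 (Or.inl ?_) : mid < z), h1⟩
        rw [h2]
        exact lt_of_le_of_ne (lexFst_mono hxy.le) (by simpa [mid] using hy.ne_zero.symm)
    · by_cases h : lexFst x = lexFst y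
      · obtain ⟨z, h1, h2, h3⟩ := exists_between_and_lexFst_eq hxy h
        exact ⟨⟨z, Or.inr (h3 ▸ hx)⟩, h1, h2⟩
      · obtain ⟨z, h1, h2⟩ := exists_gt_and_lexFst_eq x
        exact ⟨⟨z, Or.inr (h2 ▸ hx)⟩, h1, (lex_lt_iff.2 (Or.inl
          (h2.symm ▸ lt_of_le_of_ne (lexFst_mono hxy.le) h)) : z < y)⟩
  · rintro ⟨x, rfl | hx⟩
    · refine ⟨⟨lexMk (centre.elem 2) (eta.elem 0), Or.inr ?_⟩, ?_⟩
      · simpa using released_two h0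
      · exact (lexMk_lt_iff.2 (Or.inl (centre_left_lt_zero 0)) :
          lexMk (centre.elem 2) (eta.elem 0) < mid)
    · obtain ⟨z, h1, h2⟩ := exists_lt_and_lexFst_eq x
      exact ⟨⟨z, Or.inr (h2 ▸ hx)⟩, h1⟩
  · rintro ⟨x, rfl | hx⟩
    · refine ⟨⟨lexMk (centre.elem 1) (eta.elem 0), Or.inr ?_⟩, ?_⟩
      · simpa using released_one h0
      · exact (lexMk_lt_iff.2 (Or.inl (centre_zero_lt_right 0)) :
          mid < lexMk (centre.elem 1) (eta.elem 0))
    · obtain ⟨z, h1, h2⟩ := exists_gt_and_lexFst_eq x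
      exact ⟨⟨z, Or.inr (h2 ▸ hx)⟩, h1⟩

theorem exists_around_orderIso (h0 : G i 0) :
    ∃ ψ : Around G i ≃o eta, ψ ⟨mid, Or.inl rfl⟩ = eta.elem 0 := by
  obtain ⟨h1, h2, h3⟩ := Around.dense_noEndpoints h0
  exact exists_orderIso_apply_eq _ _

open Classical in
/-- The block around the `i`-th centre to which the elements at a given place belong: they join
the block of the centre unless their position is released. -/
noncomputable def aroundOf (G : ℕ → ℕ → Prop) (i : ℕ) (x : centre.lex eta) : Around G i :=
  if h : Released G i (lexFst x) then ⟨x, Or.inr h⟩ else ⟨mid, Or.inl rfl⟩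

theorem aroundOf_mono (hG : Antitone (G i)) : Monotone (aroundOf G i) := by
  intro x y hxy
  have hfst := lexFst_mono hxy
  have hm : lexFst mid = centre.elem 0 := by simp [mid]
  unfold aroundOf
  split_ifs with hx hy hy
  · exact hxy
  · refine (lex_lt_iff.2 (Or.inl ?_) : x < mid).le
    rw [hm]
    refine lt_of_not_ge fun h => ?_
    exact absurd (hx.lt_of_pos hG hy (lt_of_le_of_ne h hx.ne_zero.symm)) (not_lt.2 hfst)
  · refine (lex_lt_iff.2 (Or.inl ?_) : mid < y).le
    rw [hm]
    refine lt_of_not_ge fun h => ?_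
    exact absurd (hy.lt_of_neg hG hx (lt_of_le_of_ne h hy.ne_zero)) (not_lt.2 hfst)
  · exact le_rfl

theorem aroundOf_eq_mid_iff {x : centre.lex eta} :
    aroundOf G i x = ⟨mid, Or.inl rfl⟩ ↔ ¬ Released G i (lexFst x) := by
  unfold aroundOf
  split_ifs with h
  · simp only [Subtype.mk.injEq, h, not_true_eq_false, iff_false]
    rintro rfl
    exact h.ne_zero (by simp [mid])
  · simp [h]

theorem aroundOf_eq_iff {x : centre.lex eta} {c : Around G i} (hc : c ≠ ⟨mid, Or.inl rfl⟩) :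
    aroundOf G i x = c ↔ x = c.1 := by
  unfold aroundOf
  split_ifs with h
  · exact Subtype.ext_iff
  · refine iff_of_false hc.symm ?_
    rintro rfl
    exact h (c.2.resolve_left fun h => hc (Subtype.ext h))

end Construction

end ComputableLinearOrder

namespace ComputableLinearOrder

section Construction

variable {G : ℕ → ℕ → Prop} {i t : ℕ} {E : ComputableLinearOrder}

/-- The ambient order of the construction: each point of `E` is replaced with one copy of
`ω* + ω` for each place around a centre. -/
abbrev ambient (E : ComputableLinearOrder) : ComputableLinearOrder :=
  E.lex ((centre.lex eta).lex zeta)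

/-- The elements that are enumerated: `p` elements at the centre, with `p` the prime that belongs
to the centre; everything at the released positions; and at each position that has become current,
an `ω`-chain if it is on the right of the centre and an `ω*`-chain if it is on its left. The
positions of stage `t + 1` become current when `G i t` is found to hold, that is, when those of
stage `t` are released. Those of stage `0` are current from the start, because
`G i 0` holds and the subtraction `0 - 1` is truncated.
The code of an element is the pair of `i` with the pair of its place (which is `0` for the centre
and otherwise the pair of its position and of a point of `η`) with a code of an integer. -/
def enumerated (G : ℕ → ℕ → Prop) : Set ℕ :=
  {n | (n.unpair.2.unpair.1 = 0 ∧ n.unpair.2.unpair.2 % 2 = 0 ∧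
      n.unpair.2.unpair.2 / 2 < Nat.nth Nat.Prime (Nat.pair n.unpair.1 0)) ∨
    (0 < n.unpair.2.unpair.1.unpair.1 ∧
      (G n.unpair.1 ((n.unpair.2.unpair.1.unpair.1 - 1) / 2) ∨
        (n.unpair.2.unpair.1.unpair.2 = 0 ∧
          n.unpair.2.unpair.2 % 2 = (n.unpair.2.unpair.1.unpair.1 - 1) % 2 ∧
          G n.unpair.1 ((n.unpair.2.unpair.1.unpair.1 - 1) / 2 - 1))))}

theorem isSigma_enumerated (hG : IsSigma 1 fun x : ℕ × ℕ => G x.1 x.2) :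
    IsSigma 1 fun n => n ∈ enumerated G := by
  have u1 {g : ℕ → ℕ} (hg : Computable g) : Computable fun n => (g n).unpair.1 :=
    Computable.fst.comp (Computable.unpair.comp hg)
  have u2 {g : ℕ → ℕ} (hg : Computable g) : Computable fun n => (g n).unpair.2 :=
    Computable.snd.comp (Computable.unpair.comp hg)
  have dv {g : ℕ → ℕ} (hg : Computable g) : Computable fun n => g n / 2 :=
    Primrec.nat_div.to_comp.comp hg (Computable.const 2)
  have md {g : ℕ → ℕ} (hg : Computable g) : Computable fun n => g n % 2 :=
    Primrec.nat_mod.to_comp.comp hg (Computable.const 2)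
  have sb {g : ℕ → ℕ} (hg : Computable g) : Computable fun n => g n - 1 :=
    Primrec.nat_sub.to_comp.comp hg (Computable.const 1)
  have hi : Computable fun n : ℕ => n.unpair.1 := u1 Computable.id
  have hP : Computable fun n : ℕ => n.unpair.2.unpair.1 := u1 (u2 Computable.id)
  have hk : Computable fun n : ℕ => n.unpair.2.unpair.2 := u2 (u2 Computable.id)
  have hp : Computable fun n : ℕ => Nat.nth Nat.Prime (Nat.pair n.unpair.1 0) :=
    computable_nth_prime.comp (Primrec₂.natPair.to_comp.comp hi (Computable.const 0))
  have c {p : ℕ → Prop} (hp : ComputablePred p) : IsSigma 1 p := IsSigma.of_computablePred hp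
  have h1 := (c (computablePred_natEq hP (Computable.const 0))).and
    ((c (computablePred_natEq (md hk) (Computable.const 0))).and
      (c (computablePred_natLt (dv hk) hp)))
  have h2 := hG.comp (hi.pair (dv (sb (u1 hP))))
  have h3 := hG.comp (hi.pair (sb (dv (sb (u1 hP)))))
  exact h1.or ((c (computablePred_natLt (Computable.const 0) (u1 hP))).and
    (h2.or ((c (computablePred_natEq (u2 hP) (Computable.const 0))).and
      ((c (computablePred_natEq (md hk) (md (sb (u1 hP))))).and h3))))

/-- The element of the ambient order with code `k` in the first copy of `ω* + ω` at the position
`τ` around the `i`-th centre. -/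
def point (E : ComputableLinearOrder) (i τ k : ℕ) : ambient E :=
  lexMk (E.elem i) (lexMk (lexMk (centre.elem τ) (eta.elem 0)) (zeta.elem k))

theorem point_lt_point {σ τ k l : ℕ} : point E i σ k < point E i τ l ↔
    centre.elem σ < centre.elem τ ∨ σ = τ ∧ intOf k < intOf l := by
  simp only [point, lexMk_lt_iff, lt_irrefl, false_or, true_and, and_false, or_false]
  refine or_congr Iff.rfl (and_congr ?_ Iff.rfl)
  constructor
  · intro h
    simpa using congrArg (fun x : centre.lex eta => num (lexFst x)) h
  · rintro rfl
    rfl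

theorem mem_enumerated_of_released {x : ambient E}
    (h : Released G (num (lexFst x)) (lexFst (lexFst (lexSnd x)))) : num x ∈ enumerated G :=
  Or.inr ⟨h.1, Or.inl h.2⟩

theorem point_mem_enumerated {τ k : ℕ} (h : (τ = 0 ∧ k % 2 = 0 ∧
      k / 2 < Nat.nth Nat.Prime (Nat.pair i 0)) ∨
    (0 < τ ∧ k % 2 = (τ - 1) % 2 ∧ G i ((τ - 1) / 2 - 1))) :
    num (point E i τ k) ∈ enumerated G := by
  rcases h with ⟨rfl, hk, hlt⟩ | ⟨hτ, hk, hcur⟩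
  · refine Or.inl ⟨?_, ?_, ?_⟩ <;> simp only [point, lexMk, num_elem, Nat.unpair_pair]
    · rfl
    · exact hk
    · exact hlt
  · refine Or.inr ⟨?_, Or.inr ⟨?_, ?_, ?_⟩⟩ <;>
      simp only [point, lexMk, num_elem, Nat.unpair_pair]
    · exact hτ
    · exact hk
    · exact hcur

theorem infinite_enumerated (h0 : G 0 0) : (enumerated G).Infinite := by
  refine Set.infinite_of_injective_forall_mem (f := fun k => num (point omega 0 1 k)) ?_ fun k => ?_
  · intro k l h
    have h' : point omega 0 1 k = point omega 0 1 l := h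
    simpa [point] using congrArg (fun x : ambient omega => num (lexSnd (lexSnd x))) h'
  · refine mem_enumerated_of_released ?_
    simpa [point] using released_one h0

variable (hG : ∀ i, Antitone (G i)) (ψ : ∀ i, Around G i ≃o eta)

/-- The map that sends an element of the ambient order to the point of `E × η` whose block
it belongs to. -/
noncomputable def blockOf (x : ambient E) : E.lex eta :=
  lexMk (lexFst x) (ψ (num (lexFst x)) (aroundOf G (num (lexFst x)) (lexFst (lexSnd x))))

include hG in
theorem blockOf_mono : Monotone (blockOf ψ : ambient E → E.lex eta) := by
  intro x y hxy
  rcases lex_le_iff.1 hxy with h | ⟨h1, h2⟩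
  · exact (lexMk_lt_iff.2 (Or.inl h)).le
  · refine lex_le_iff.2 (Or.inr ⟨by simpa [blockOf] using h1, ?_⟩)
    simp only [blockOf, lexSnd_mk]
    rw [h1]
    exact (ψ _).monotone (aroundOf_mono (hG _) (lexFst_mono h2))

variable {ψ} {r : ℕ}

theorem blockOf_eq_iff {x : ambient E} : blockOf ψ x = (E.lex eta).elem (Nat.pair i r) ↔
    lexFst x = E.elem i ∧ aroundOf G i (lexFst (lexSnd x)) = (ψ i).symm (eta.elem r) := by
  have : (E.lex eta).elem (Nat.pair i r) = lexMk (E.elem i) (eta.elem r) := rfl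
  rw [this]
  constructor
  · intro h
    have h1 : num (lexFst x) = i := by
      simpa [blockOf] using congrArg (fun y : E.lex eta => num (lexFst y)) h
    have h2 := congrArg lexSnd h
    subst h1
    simp only [blockOf, lexSnd_mk] at h2
    exact ⟨rfl, (OrderIso.eq_symm_apply _).2 h2⟩
  · rintro ⟨h1, h2⟩
    obtain rfl : num (lexFst x) = i := by rw [h1, num_elem]
    refine lex_ext (by simp [blockOf]) ?_
    simp only [blockOf, lexSnd_mk]
    exact (OrderIso.eq_symm_apply _).1 h2

/-- The enumerated elements of the block that replaces the point `(i, r)` of `E × η`. -/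
abbrev Fibre (E : ComputableLinearOrder) (ψ : ∀ i, Around G i ≃o eta) (i r : ℕ) : Type :=
  {x : (ambient E).Suborder (enumerated G) //
    blockOf ψ x.1 = (E.lex eta).elem (Nat.pair i r)}

variable (hψ : ∀ i, ψ i ⟨mid, Or.inl rfl⟩ = eta.elem 0)

include hψ

theorem symm_eq_mid_iff : (ψ i).symm (eta.elem r) = ⟨mid, Or.inl rfl⟩ ↔ r = 0 := by
  rw [OrderIso.symm_apply_eq, hψ, elem_inj]

/-- Away from the centres, every block has type `ω* + ω`. -/
theorem nonempty_fibre_orderIso_of_ne_zero (hr : r ≠ 0) : Nonempty (Fibre E ψ i r ≃o ℤ) := by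
  set c := (ψ i).symm (eta.elem r) with hc
  have hcm : c ≠ ⟨mid, Or.inl rfl⟩ := mt (symm_eq_mid_iff hψ).1 hr
  have hrel : Released G i (lexFst c.1) := c.2.resolve_left fun h => hcm (Subtype.ext h)
  have hmem : ∀ x : Fibre E ψ i r, lexFst x.1.1 = E.elem i ∧ lexFst (lexSnd x.1.1) = c.1 := by
    intro x
    obtain ⟨h1, h2⟩ := blockOf_eq_iff.1 x.2
    exact ⟨h1, (aroundOf_eq_iff hcm).1 h2⟩
  let h : Fibre E ψ i r → ℤ := fun x => intOf (num (lexSnd (lexSnd x.1.1)))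
  have hh : StrictMono h := by
    intro x y hxy
    have h1 := (lex_lt_iff.1 (show x.1.1 < y.1.1 from hxy)).resolve_left
      (by rw [(hmem x).1, (hmem y).1]; exact lt_irrefl _)
    exact ((lex_lt_iff.1 h1.2).resolve_left
      (by rw [(hmem x).2, (hmem y).2]; exact lt_irrefl _)).2
  refine ⟨hh.orderIsoOfSurjective h fun z => ?_⟩
  obtain ⟨k, rfl⟩ := intOf_bijective.2 z
  let x : ambient E := lexMk (E.elem i) (lexMk c.1 (zeta.elem k))
  have hx : num x ∈ enumerated G := mem_enumerated_of_released (by simpa [x] using hrel)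
  refine ⟨⟨⟨x, _, hx, rfl⟩, blockOf_eq_iff.2 ⟨by simp [x], ?_⟩⟩, by simp [h, x]⟩
  exact (aroundOf_eq_iff hcm).2 (by simp [x])

theorem blockOf_centre_iff {x : ambient E} : blockOf ψ x = (E.lex eta).elem (Nat.pair i 0) ↔
    lexFst x = E.elem i ∧ ¬ Released G i (lexFst (lexFst (lexSnd x))) := by
  rw [blockOf_eq_iff, (symm_eq_mid_iff hψ).2 rfl, aroundOf_eq_mid_iff]

omit hψ in
theorem eq_point {x : ambient E} {τ k : ℕ} (h1 : lexFst x = E.elem i)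
    (h2 : num (lexFst (lexSnd x)) = Nat.pair τ 0) (h3 : num (lexSnd (lexSnd x)) = k) :
    x = point E i τ k :=
  have h2' : lexFst (lexSnd x) = lexMk (centre.elem τ) (eta.elem 0) := h2
  have h3' : lexSnd (lexSnd x) = zeta.elem k := h3
  lex_ext (by rw [h1, point, lexFst_mk]) (lex_ext (by rw [h2', point, lexSnd_mk, lexFst_mk])
    (by rw [h3', point, lexSnd_mk, lexSnd_mk]))

/-- If every position around the `i`-th centre is released, then the block of the centre has the
prime size that belongs to it. -/
theorem nonempty_fibre_orderIso_fin (hi : ∀ t, G i t) :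
    Nonempty (Fibre E ψ i 0 ≃o Fin (Nat.nth Nat.Prime (Nat.pair i 0))) := by
  let h : Fin (Nat.nth Nat.Prime (Nat.pair i 0)) → Fibre E ψ i 0 := fun j =>
    ⟨⟨point E i 0 (2 * j), num (point E i 0 (2 * j)),
      point_mem_enumerated (Or.inl ⟨rfl, by omega, by omega⟩), rfl⟩,
      (blockOf_centre_iff hψ).2 ⟨by simp [point], by simp [point, Released]⟩⟩
  have hh : StrictMono h := by
    intro j l hjl
    refine (point_lt_point.2 (Or.inr ⟨rfl, ?_⟩) : point E i 0 (2 * j) < point E i 0 (2 * l))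
    rw [intOf_even, intOf_even]
    exact_mod_cast hjl
  refine ⟨(hh.orderIsoOfSurjective h ?_).symm⟩
  rintro ⟨⟨x, n, hn, rfl⟩, hx⟩
  obtain ⟨h1, h2⟩ := (blockOf_centre_iff hψ).1 hx
  have h1' : n.unpair.1 = i := h1
  rcases hn with ⟨hP, hk, hlt⟩ | ⟨hτ, _⟩
  · rw [h1'] at hlt
    refine ⟨⟨_, hlt⟩, Subtype.ext (Subtype.ext (eq_point (τ := 0) h1 hP ?_).symm)⟩
    exact (Nat.mul_div_cancel' (Nat.dvd_of_mod_eq_zero hk)).symm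
  · exact absurd (⟨hτ, hi _⟩ : Released G i (lexFst (lexFst (lexSnd _)))) h2

/-- If the positions of stage `t + 1` are the last ones to become current, then the chains
there stay next to the centre, and the block of the centre has type `ω* + ω`. -/
theorem nonempty_fibre_orderIso_int (hG : ∀ i, Antitone (G i)) (ht : G i t)
    (ht' : ¬ G i (t + 1)) : Nonempty (Fibre E ψ i 0 ≃o ℤ) := by
  set p := Nat.nth Nat.Prime (Nat.pair i 0) with hp
  have hB : ∀ τ k, τ = 0 ∨ (τ - 1) / 2 = t + 1 →
      blockOf ψ (point E i τ k) = (E.lex eta).elem (Nat.pair i 0) := by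
    intro τ k hτ
    refine (blockOf_centre_iff hψ).2 ⟨by simp [point], ?_⟩
    simp only [point, lexFst_mk, lexSnd_mk]
    rintro ⟨h1, h2⟩
    rw [num_elem] at h1 h2
    rcases hτ with rfl | hτ
    · exact lt_irrefl _ h1
    · exact ht' (hτ ▸ h2)
  -- The integers below `0`, those from `0` to `p - 1`, and those from `p` on number the chain on
  -- the left, the centre, and the chain on the right.
  let h : ℤ → Fibre E ψ i 0 := fun z =>
    if hz : z < 0 then
      ⟨⟨point E i (2 * (t + 1) + 2) (2 * (-z - 1).toNat + 1), _, point_mem_enumerated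
        (Or.inr ⟨by omega, by omega, by convert ht using 1; omega⟩), rfl⟩,
        hB _ _ (Or.inr (by omega))⟩
    else if hz' : z < p then
      ⟨⟨point E i 0 (2 * z.toNat), _, point_mem_enumerated
        (Or.inl ⟨rfl, by omega, by omega⟩), rfl⟩, hB _ _ (Or.inl rfl)⟩
    else
      ⟨⟨point E i (2 * (t + 1) + 1) (2 * (z - p).toNat), _, point_mem_enumerated
        (Or.inr ⟨by omega, by omega, by convert ht using 1; omega⟩), rfl⟩,
        hB _ _ (Or.inr (by omega))⟩
  have hneg : ∀ z < 0, (h z).1.1 = point E i (2 * (t + 1) + 2) (2 * (-z - 1).toNat + 1) := by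
    intro z hz
    simp only [h, hz, dif_pos]
  have hmid : ∀ z : ℤ, ¬ z < 0 → z < p → (h z).1.1 = point E i 0 (2 * z.toNat) := by
    intro z hz hz'
    simp only [h, hz, hz', dif_pos, dif_neg, not_false_iff]
  have hpos : ∀ z : ℤ, ¬ z < p → (h z).1.1 = point E i (2 * (t + 1) + 1) (2 * (z - p).toNat) := by
    intro z hz'
    have hz : ¬ z < 0 := by omega
    simp only [h, hz, hz', dif_neg, not_false_iff]
  have hh : StrictMono h := by
    intro z w hzw
    change (h z).1.1 < (h w).1.1
    by_cases hz : z < 0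
    · rw [hneg z hz]
      by_cases hw : w < 0
      · rw [hneg w hw, point_lt_point, intOf_odd, intOf_odd]
        exact Or.inr ⟨rfl, by omega⟩
      · by_cases hw' : w < p
        · rw [hmid w hw hw', point_lt_point]
          exact Or.inl (centre_left_lt_zero (t + 1))
        · rw [hpos w hw', point_lt_point]
          exact Or.inl (centre_left_lt_right (t + 1) (t + 1))
    · by_cases hw' : w < p
      · rw [hmid z hz (by omega), hmid w (by omega) hw', point_lt_point, intOf_even, intOf_even]
        exact Or.inr ⟨rfl, by omega⟩
      · rw [hpos w hw']
        by_cases hz' : z < p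
        · rw [hmid z hz hz', point_lt_point]
          exact Or.inl (centre_zero_lt_right (t + 1))
        · rw [hpos z hz', point_lt_point, intOf_even, intOf_even]
          exact Or.inr ⟨rfl, by omega⟩
  refine ⟨(hh.orderIsoOfSurjective h ?_).symm⟩
  rintro ⟨⟨x, n, hn, rfl⟩, hx⟩
  obtain ⟨h1, h2⟩ := (blockOf_centre_iff hψ).1 hx
  have h1' : n.unpair.1 = i := h1
  suffices ∃ z, (h z).1.1 = (ambient E).elem n from this.imp fun z hz =>
    Subtype.ext (Subtype.ext hz)
  rcases hn with ⟨hP, hk, hlt⟩ | ⟨hτ, hcase⟩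
  · rw [h1', ← hp] at hlt
    refine ⟨((n.unpair.2.unpair.2 / 2 : ℕ) : ℤ), ?_⟩
    rw [hmid _ (by omega) (by omega), Int.toNat_natCast]
    exact (eq_point (τ := 0) h1 hP (Nat.mul_div_cancel' (Nat.dvd_of_mod_eq_zero hk)).symm).symm
  · have hnot : ¬ G i ((n.unpair.2.unpair.1.unpair.1 - 1) / 2) := fun h => h2 ⟨hτ, h⟩
    rw [h1'] at hcase
    obtain ⟨hq, hpar, hcur⟩ := hcase.resolve_left hnot
    have hstage : (n.unpair.2.unpair.1.unpair.1 - 1) / 2 = t + 1 := by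
      have h3 : t < (n.unpair.2.unpair.1.unpair.1 - 1) / 2 := by
        by_contra hle
        exact hnot (hG i (not_lt.1 hle) ht)
      have h4 : (n.unpair.2.unpair.1.unpair.1 - 1) / 2 - 1 < t + 1 := by
        by_contra hle
        exact ht' (hG i (not_lt.1 hle) hcur)
      omega
    have hpair : n.unpair.2.unpair.1 = Nat.pair n.unpair.2.unpair.1.unpair.1 0 := by
      conv_lhs => rw [← Nat.pair_unpair n.unpair.2.unpair.1, hq]
    have heq : (ambient E).elem n = _ := eq_point (k := n.unpair.2.unpair.2) h1 hpair rfl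
    rw [heq]
    clear heq
    generalize n.unpair.2.unpair.1.unpair.1 = σ at hpar hstage ⊢
    generalize n.unpair.2.unpair.2 = m at hpar ⊢
    rcases Nat.mod_two_eq_zero_or_one m with hm | hm
    · refine ⟨p + (m / 2 : ℕ), ?_⟩
      rw [hpos _ (by omega)]
      congr 1 <;> omega
    · refine ⟨-((m / 2 : ℕ) + 1), ?_⟩
      rw [hneg _ (by omega)]
      congr 1 <;> omega

end Construction

/-- The points of a computable linear order `E`, together with the points of `η` around each of
them, can be replaced with blocks: those in a given `Π₂` set `A` of points of `E` with blocks of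
prime size, and all the others with blocks of type `ω* + ω`, so that a computable linear order
results. -/
theorem exists_isPrimeBlockReplacement (E : ComputableLinearOrder) {A : Set ℕ} (hA : IsPi2 A) :
    ∃ L : ComputableLinearOrder,
      IsPrimeBlockReplacement L (E.lex eta) {n | ∃ i ∈ A, n = Nat.pair i 0} := by
  obtain ⟨G, hGs, h0, hG, hGA⟩ := exists_antitone_approximation hA
  choose ψ hψ using fun i => exists_around_orderIso (h0 i)
  obtain ⟨L, ⟨g⟩⟩ := (ambient E).exists_orderIso_suborder (isSigma_enumerated hGs)
    (infinite_enumerated (h0 0))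
  refine ⟨L, isPrimeBlockReplacement_of_orderIso g (f := fun x => blockOf ψ x.1)
    (fun x y hxy => blockOf_mono hG ψ hxy) ?_ fun n hn => ?_⟩
  · rintro _ ⟨i, hi, rfl⟩
    exact nonempty_fibre_orderIso_fin hψ ((hGA i).1 hi)
  · rw [← Nat.pair_unpair n] at hn ⊢
    generalize n.unpair.1 = i at *
    generalize n.unpair.2 = r at *
    by_cases hr : r = 0
    · subst hr
      have hi : ¬ ∀ t, G i t := fun h => hn ⟨i, (hGA i).2 h, rfl⟩
      obtain ⟨t, ht, ht'⟩ : ∃ t, G i t ∧ ¬ G i (t + 1) := by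
        by_contra hcon
        push Not at hcon
        exact hi fun t => Nat.rec (h0 i) hcon t
      exact nonempty_fibre_orderIso_int hψ hG ht ht'
    · exact nonempty_fibre_orderIso_of_ne_zero hψ hr

end ComputableLinearOrder

open ComputableLinearOrder

/-! ### Maximal runs of consecutive elements -/

/-- The order has a maximal run of `k + 1` consecutive elements: its first element has no
immediate predecessor and its last element has no immediate successor. -/
def HasRun (α : Type*) [LinearOrder α] (k : ℕ) : Prop :=
  ∃ u : ℕ → α, (∀ j < k, u j ⋖ u (j + 1)) ∧ (∀ z, ¬ z ⋖ u 0) ∧ ∀ z, ¬ u k ⋖ z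

theorem HasRun.of_orderIso {α β : Type*} [LinearOrder α] [LinearOrder β] {k : ℕ} (h : HasRun α k)
    (e : α ≃o β) : HasRun β k := by
  obtain ⟨u, h1, h2, h3⟩ := h
  refine ⟨fun j => e (u j), fun j hj => (apply_covBy_apply_iff e).2 (h1 j hj), fun z hz => ?_,
    fun z hz => ?_⟩
  · exact h2 (e.symm z) ((apply_covBy_apply_iff e).1 (by simpa using hz))
  · exact h3 (e.symm z) ((apply_covBy_apply_iff e).1 (by simpa using hz))

theorem covBy_suborder_iff {M : ComputableLinearOrder} {P : Set ℕ} {x y : M.Suborder P} :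
    x ⋖ y ↔ x.1 < y.1 ∧ ∀ w, w ∈ P → ¬ (x.1 < M.elem w ∧ M.elem w < y.1) := by
  constructor
  · rintro ⟨h1, h2⟩
    exact ⟨h1, fun w hw h => h2 (c := ⟨M.elem w, w, hw, rfl⟩) h.1 h.2⟩
  · rintro ⟨h1, h2⟩
    refine ⟨h1, fun z hz hz' => ?_⟩
    obtain ⟨_, w, hw, rfl⟩ := z
    exact h2 w hw ⟨hz, hz'⟩

/-- In a `Π₁` suborder of a computable linear order, being consecutive is `Π₂`, having no immediate
predecessor is `Π₃`, and having a maximal run of a given length is `Σ₄`. -/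
theorem isSigma_hasRun (M : ComputableLinearOrder) {P : Set ℕ} (hP : IsPi1 P) :
    IsSigma 4 fun n => HasRun (M.Suborder P) (2 * n + 1) := by
  rw [isPi1_iff] at hP
  have hcov : IsPi 2 fun p : ℕ × ℕ => M.elem p.1 < M.elem p.2 ∧
      ∀ w, w ∈ P → ¬ (M.elem p.1 < M.elem w ∧ M.elem w < M.elem p.2) := by
    have h1 : Computable fun p : (ℕ × ℕ) × ℕ => p.1.1 := Computable.fst.comp Computable.fst
    have h2 : Computable fun p : (ℕ × ℕ) × ℕ => p.1.2 := Computable.snd.comp Computable.fst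
    have h3 : Computable fun p : (ℕ × ℕ) × ℕ => p.2 := Computable.snd
    have hb : ComputablePred fun p : (ℕ × ℕ) × ℕ =>
        ¬ (M.elem p.1.1 < M.elem p.2 ∧ M.elem p.2 < M.elem p.1.2) :=
      ((M.computablePred_lt h1 h3).and_computable (M.computablePred_lt h3 h2)).not
    exact (IsPi.of_computablePred (M.computablePred_lt Computable.fst Computable.snd)).and
      (IsSigma.imp (k := 1) (hP.comp h3) (IsSigma.of_computablePred hb)).forall
  set C : ℕ → ℕ → Prop := fun x y => M.elem x < M.elem y ∧
      ∀ w, w ∈ P → ¬ (M.elem x < M.elem w ∧ M.elem w < M.elem y) with hC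
  have key : ∀ n, HasRun (M.Suborder P) (2 * n + 1) ↔ ∃ l,
      (∀ j, j < 2 * n + 2 → listEntry l j ∈ P) ∧
      (∀ j, j < 2 * n + 1 → C (listEntry l j) (listEntry l (j + 1))) ∧
      (∀ z, z ∈ P → ¬ C z (listEntry l 0)) ∧
      (∀ z, z ∈ P → ¬ C (listEntry l (2 * n + 1)) z) := by
    intro n
    constructor
    · rintro ⟨u, h1, h2, h3⟩
      obtain ⟨l, hl⟩ := (forall_lt_exists_iff (Q := fun j b => num (u j).1 = b)
        (t := 2 * n + 2)).1 fun j _ => ⟨_, rfl⟩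
      have hl' : ∀ j < 2 * n + 2, (u j).1 = M.elem (listEntry l j) := fun j hj => hl j hj
      refine ⟨l, fun j hj => ?_, fun j hj => ?_, fun z hz h => ?_, fun z hz h => ?_⟩
      · obtain ⟨w, hw, hw'⟩ := (u j).2
        rwa [← hl j hj, ← hw', num_elem]
      · have := covBy_suborder_iff.1 (h1 j hj)
        rwa [hl' j (by omega), hl' (j + 1) (by omega)] at this
      · refine h2 ⟨M.elem z, z, hz, rfl⟩ (covBy_suborder_iff.2 ?_)
        rw [hl' 0 (by omega)]
        exact h
      · refine h3 ⟨M.elem z, z, hz, rfl⟩ (covBy_suborder_iff.2 ?_)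
        rw [hl' (2 * n + 1) (by omega)]
        exact h
    · rintro ⟨l, h0, h1, h2, h3⟩
      let u : ℕ → M.Suborder P := fun j => if h : j < 2 * n + 2 then
        ⟨M.elem (listEntry l j), _, h0 j h, rfl⟩ else
        ⟨M.elem (listEntry l 0), _, h0 0 (by omega), rfl⟩
      have hu : ∀ j < 2 * n + 2, (u j).1 = M.elem (listEntry l j) := fun j hj => by
        simp only [u, hj, dif_pos]
      refine ⟨u, fun j hj => covBy_suborder_iff.2 ?_, fun z hz => ?_, fun z hz => ?_⟩
      · rw [hu j (by omega), hu (j + 1) (by omega)]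
        exact h1 j hj
      · obtain ⟨_, z, hzP, rfl⟩ := z
        have := covBy_suborder_iff.1 hz
        rw [hu 0 (by omega)] at this
        exact h2 z hzP this
      · obtain ⟨_, z, hzP, rfl⟩ := z
        have := covBy_suborder_iff.1 hz
        rw [hu (2 * n + 1) (by omega)] at this
        exact h3 z hzP this
  have hn : Computable fun x : (ℕ × ℕ) × ℕ => x.1.1 := Computable.fst.comp Computable.fst
  have hl : Computable fun x : (ℕ × ℕ) × ℕ => x.1.2 := Computable.snd.comp Computable.fst
  have hj : Computable fun x : (ℕ × ℕ) × ℕ => x.2 := Computable.snd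
  have hn1 : Computable fun x : (ℕ × ℕ) × ℕ => 2 * x.1.1 + 1 :=
    Primrec.nat_double_succ.to_comp.comp hn
  have e {f : (ℕ × ℕ) × ℕ → ℕ} (hf : Computable f) : Computable fun x => listEntry x.1.2 (f x) :=
    computable₂_listEntry.comp hl hf
  have c1 : IsPi 3 fun x : ℕ × ℕ => ∀ j, j < 2 * x.1 + 2 → listEntry x.2 j ∈ P :=
    IsPi.forall (k := 2)
      (p := fun x : (ℕ × ℕ) × ℕ => x.2 < 2 * x.1.1 + 2 → listEntry x.1.2 x.2 ∈ P)
      (IsPi.imp (IsSigma.of_computablePred (computablePred_natLt hj (Computable.succ.comp hn1)))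
        (hP.comp (e hj)).succ.succ)
  have c2 : IsPi 3 fun x : ℕ × ℕ => ∀ j, j < 2 * x.1 + 1 →
      C (listEntry x.2 j) (listEntry x.2 (j + 1)) :=
    IsPi.forall (k := 2) (p := fun x : (ℕ × ℕ) × ℕ => x.2 < 2 * x.1.1 + 1 →
        C (listEntry x.1.2 x.2) (listEntry x.1.2 (x.2 + 1)))
      (IsPi.imp (IsSigma.of_computablePred (computablePred_natLt hj hn1))
        (hcov.comp ((e hj).pair (e (Computable.succ.comp hj)))).succ)
  have c3 : IsPi 3 fun x : ℕ × ℕ => ∀ z, z ∈ P → ¬ C z (listEntry x.2 0) :=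
    IsSigma.forall (k := 2) (p := fun x : (ℕ × ℕ) × ℕ => x.2 ∈ P → ¬ C x.2 (listEntry x.1.2 0))
      (IsSigma.imp (hP.comp hj).succ (hcov.comp (hj.pair (e (Computable.const 0)))).not)
  have c4 : IsPi 3 fun x : ℕ × ℕ => ∀ z, z ∈ P → ¬ C (listEntry x.2 (2 * x.1 + 1)) z :=
    IsSigma.forall (k := 2)
      (p := fun x : (ℕ × ℕ) × ℕ => x.2 ∈ P → ¬ C (listEntry x.1.2 (2 * x.1.1 + 1)) x.2)
      (IsSigma.imp (hP.comp hj).succ (hcov.comp ((e hn1).pair hj)).not)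
  exact (c1.and (c2.and (c3.and c4))).exists.congr key

/-! ### A `Π₂` suborder whose runs code a `Π₄` set -/

/-- The first `a` entries of the list with code `b` witness the first `a` instances of the
statement `DiagPi4 n`. -/
def Witnesses (n a b : ℕ) : Prop :=
  ∀ m, m < a → ∀ c : ℕ, ∃ t, (Nat.Partrec.Code.evaln t (Denumerable.ofNat Nat.Partrec.Code n)
    (Encodable.encode (((n, m), listEntry b m), c))).isSome

theorem witnesses_zero (n b : ℕ) : Witnesses n 0 b := fun _ h => absurd h (Nat.not_lt_zero _)

theorem diagPi4_iff {n : ℕ} : DiagPi4 n ↔ ∀ a, ∃ b, Witnesses n a b := by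
  constructor
  · intro h a
    exact forall_lt_exists_iff.1 fun m _ => h m
  · intro h a
    obtain ⟨b, hb⟩ := h (a + 1)
    exact ⟨_, hb a a.lt_succ_self⟩

theorem Witnesses.mono {n a a' b : ℕ} (h : Witnesses n a b) (ha : a' ≤ a) : Witnesses n a' b :=
  fun m hm => h m (hm.trans_le ha)

theorem isPi_witnesses : IsPi 2 fun x : (ℕ × ℕ) × ℕ => Witnesses x.1.1 x.1.2 x.2 := by
  have f1 {α β : Type} [Primcodable α] [Primcodable β] : Computable fun x : α × β => x.1 :=
    Computable.fst
  have hn : Computable fun x : ((((ℕ × ℕ) × ℕ) × ℕ) × ℕ) × ℕ => x.1.1.1.1.1 :=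
    f1.comp (f1.comp (f1.comp (f1.comp f1)))
  have hb : Computable fun x : ((((ℕ × ℕ) × ℕ) × ℕ) × ℕ) × ℕ => x.1.1.1.2 :=
    Computable.snd.comp (f1.comp (f1.comp f1))
  have hm : Computable fun x : ((((ℕ × ℕ) × ℕ) × ℕ) × ℕ) × ℕ => x.1.1.2 :=
    Computable.snd.comp (f1.comp f1)
  have hc : Computable fun x : ((((ℕ × ℕ) × ℕ) × ℕ) × ℕ) × ℕ => x.1.2 := Computable.snd.comp f1
  have h0 := computablePred_evaln (Computable.snd (α := (((ℕ × ℕ) × ℕ) × ℕ) × ℕ) (β := ℕ)) hn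
    (Computable.encode.comp (((hn.pair hm).pair (computable₂_listEntry.comp hb hm)).pair hc))
  have hlt : ComputablePred fun x : ((ℕ × ℕ) × ℕ) × ℕ => x.2 < x.1.1.2 :=
    computablePred_natLt Computable.snd (Computable.snd.comp (f1.comp f1))
  exact (IsPi.imp (IsSigma.of_computablePred hlt) (isPi_zero.2 h0).exists.forall).forall

/-- The computable linear order in which the coding takes place. -/
abbrev codingOrder : ComputableLinearOrder := omega.lex (centre.lex (omegaStar.lex eta))

/-- The point of the coding order with the given coordinates. -/
def codingPoint (n τ b r : ℕ) : codingOrder :=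
  lexMk (omega.elem n) (lexMk (centre.elem τ) (lexMk (omegaStar.elem b) (eta.elem r)))

theorem codingPoint_lt {n τ b r n' τ' b' r' : ℕ} :
    codingPoint n τ b r < codingPoint n' τ' b' r' ↔ n < n' ∨ n = n' ∧
      (centre.elem τ < centre.elem τ' ∨ τ = τ' ∧
        (b' < b ∨ b = b' ∧ eta.elem r < eta.elem r')) := by
  simp only [codingPoint, lexMk_lt_iff, elem_inj, omega_lt, omegaStar_lt]

/-- The coding set. Its `n`-th part has `2n + 2` consecutive points at the centre. Below them, the
position of stage `a` holds a copy of `η + 1`, the points of `η` up to the one with number `0`, for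
each `b` that witnesses the first `a` instances of `DiagPi4 n`. These copies are arranged in type
`ω*`, so their sum is empty or of type `η + 1`. Stage `0` is always inhabited, which separates the
centres from one another. -/
def codingSet : Set ℕ :=
  {x | (x.unpair.2.unpair.1 = 0 ∧ x.unpair.2.unpair.2.unpair.1 < 2 * x.unpair.1 + 2 ∧
      x.unpair.2.unpair.2.unpair.2 = 0) ∨
    (0 < x.unpair.2.unpair.1 ∧ x.unpair.2.unpair.1 % 2 = 0 ∧
      ¬ eta.elem 0 < eta.elem x.unpair.2.unpair.2.unpair.2 ∧
      Witnesses x.unpair.1 (x.unpair.2.unpair.1 / 2 - 1) x.unpair.2.unpair.2.unpair.1)}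

theorem isPi2_codingSet : IsPi2 codingSet := by
  rw [isPi2_iff]
  have u1 {g : ℕ → ℕ} (hg : Computable g) : Computable fun n => (g n).unpair.1 :=
    Computable.fst.comp (Computable.unpair.comp hg)
  have u2 {g : ℕ → ℕ} (hg : Computable g) : Computable fun n => (g n).unpair.2 :=
    Computable.snd.comp (Computable.unpair.comp hg)
  have hn : Computable fun x : ℕ => x.unpair.1 := u1 Computable.id
  have hτ : Computable fun x : ℕ => x.unpair.2.unpair.1 := u1 (u2 Computable.id)
  have hb : Computable fun x : ℕ => x.unpair.2.unpair.2.unpair.1 := u1 (u2 (u2 Computable.id))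
  have hr : Computable fun x : ℕ => x.unpair.2.unpair.2.unpair.2 := u2 (u2 (u2 Computable.id))
  have h2 : Computable fun x : ℕ => 2 * x.unpair.1 + 2 :=
    Computable.succ.comp (Primrec.nat_double_succ.to_comp.comp hn)
  have hmod : Computable fun x : ℕ => x.unpair.2.unpair.1 % 2 :=
    Primrec.nat_mod.to_comp.comp hτ (Computable.const 2)
  have hstage : Computable fun x : ℕ => x.unpair.2.unpair.1 / 2 - 1 :=
    Primrec.nat_sub.to_comp.comp (Primrec.nat_div.to_comp.comp hτ (Computable.const 2))
      (Computable.const 1)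
  have c {p : ℕ → Prop} (hp : ComputablePred p) : IsPi 2 p := IsPi.of_computablePred hp
  have d1 := (c (computablePred_natEq hτ (Computable.const 0))).and
    ((c (computablePred_natLt hb h2)).and (c (computablePred_natEq hr (Computable.const 0))))
  have d2 := (c (computablePred_natEq hmod (Computable.const 0))).and
    ((c (ComputablePred.not (eta.computablePred_lt (Computable.const 0) hr))).and
      (isPi_witnesses.comp ((hn.pair hstage).pair hb)))
  exact d1.or ((c (computablePred_natLt (Computable.const 0) hτ)).and d2)

/-- The coding set as a linear order. -/
abbrev Coding : Type := codingOrder.Suborder codingSet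

theorem codingPoint_mem {n τ b r : ℕ} : num (codingPoint n τ b r) ∈ codingSet ↔
    (τ = 0 ∧ b < 2 * n + 2 ∧ r = 0) ∨ (0 < τ ∧ τ % 2 = 0 ∧ ¬ eta.elem 0 < eta.elem r ∧
      Witnesses n (τ / 2 - 1) b) := by
  have h : num (codingPoint n τ b r) = Nat.pair n (Nat.pair τ (Nat.pair b r)) := rfl
  rw [h]
  simp only [codingSet, Set.mem_ofPred_eq, Nat.unpair_pair]

/-- The consecutive points at the centre of the `n`-th part, in decreasing order. -/
def corePoint (n b : ℕ) (hb : b < 2 * n + 2) : Coding :=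
  ⟨codingPoint n 0 b 0, num (codingPoint n 0 b 0), codingPoint_mem.2 (Or.inl ⟨rfl, hb, rfl⟩), rfl⟩

/-- The points below the centre of the `n`-th part. -/
def lowPoint (n a b r : ℕ) (hr : ¬ eta.elem 0 < eta.elem r) (hw : Witnesses n a b) : Coding :=
  ⟨codingPoint n (2 * a + 2) b r, num (codingPoint n (2 * a + 2) b r),
    codingPoint_mem.2 (Or.inr ⟨by omega, by omega, hr, by
      rwa [show (2 * a + 2) / 2 - 1 = a by omega]⟩), rfl⟩

theorem coding_cases (x : Coding) : (∃ n b hb, x = corePoint n b hb) ∨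
    ∃ n a b r hr hw, x = lowPoint n a b r hr hw := by
  obtain ⟨x, m, hx, rfl⟩ := x
  obtain ⟨n, τ, b, r, rfl⟩ : ∃ n τ b r, m = num (codingPoint n τ b r) :=
    ⟨m.unpair.1, m.unpair.2.unpair.1, m.unpair.2.unpair.2.unpair.1, m.unpair.2.unpair.2.unpair.2,
      by simp only [codingPoint, lexMk, num_elem, Nat.pair_unpair]⟩
  rcases codingPoint_mem.1 hx with ⟨rfl, hb, rfl⟩ | ⟨hτ, hmod, hr, hw⟩
  · exact Or.inl ⟨n, b, hb, rfl⟩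
  · obtain ⟨a, rfl⟩ : ∃ a, τ = 2 * a + 2 := ⟨τ / 2 - 1, by omega⟩
    rw [show (2 * a + 2) / 2 - 1 = a by omega] at hw
    exact Or.inr ⟨n, a, b, r, hr, hw, rfl⟩

section Order

variable {n n' a a' b b' r r' : ℕ} {hb : b < 2 * n + 2} {hb' : b' < 2 * n' + 2}
  {hr : ¬ eta.elem 0 < eta.elem r} {hw : Witnesses n a b}
  {hr' : ¬ eta.elem 0 < eta.elem r'} {hw' : Witnesses n' a' b'}

theorem corePoint_lt_corePoint :
    corePoint n b hb < corePoint n' b' hb' ↔ n < n' ∨ n = n' ∧ b' < b := by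
  refine codingPoint_lt.trans ?_
  simp

theorem lowPoint_lt_corePoint : lowPoint n a b r hr hw < corePoint n' b' hb' ↔ n ≤ n' := by
  refine codingPoint_lt.trans ?_
  simp only [centre_left_lt_zero, true_or, and_true]
  exact le_iff_lt_or_eq.symm

theorem corePoint_lt_lowPoint : corePoint n b hb < lowPoint n' a' b' r' hr' hw' ↔ n < n' := by
  refine codingPoint_lt.trans ?_
  have := (centre_left_lt_zero a').not_gt
  simp [this]

theorem lowPoint_lt_lowPoint : lowPoint n a b r hr hw < lowPoint n' a' b' r' hr' hw' ↔
    n < n' ∨ n = n' ∧ (a < a' ∨ a = a' ∧ (b' < b ∨ b = b' ∧ eta.elem r < eta.elem r')) := by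
  refine codingPoint_lt.trans ?_
  rw [centre_left_lt_left]
  simp

end Order

theorem corePoint_covBy {n b : ℕ} (hb : b + 1 < 2 * n + 2) :
    corePoint n (b + 1) hb ⋖ corePoint n b (by omega) := by
  refine ⟨corePoint_lt_corePoint.2 (Or.inr ⟨rfl, b.lt_succ_self⟩), fun z h1 h2 => ?_⟩
  rcases coding_cases z with ⟨m, c, hc, rfl⟩ | ⟨m, a, c, r, hr, hw, rfl⟩
  · rw [corePoint_lt_corePoint] at h1 h2; omega
  · rw [corePoint_lt_lowPoint] at h1
    rw [lowPoint_lt_corePoint] at h2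
    omega

theorem not_lowPoint_covBy {n a b r : ℕ} {hr : ¬ eta.elem 0 < eta.elem r}
    {hw : Witnesses n a b} {z : Coding} : ¬ z ⋖ lowPoint n a b r hr hw := by
  rintro ⟨h1, h2⟩
  -- Between `z` and the given point there is a smaller point of the same copy of `η + 1`.
  suffices ∃ s, eta.elem s < eta.elem r ∧ ∀ hs, z < lowPoint n a b s hs hw by
    obtain ⟨s, hs, h⟩ := this
    refine h2 (h fun h0 => hr (h0.trans hs)) (lowPoint_lt_lowPoint.2 ?_)
    exact Or.inr ⟨rfl, Or.inr ⟨rfl, Or.inr ⟨rfl, hs⟩⟩⟩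
  obtain ⟨s, hs⟩ := exists_lt (eta.elem r)
  rcases coding_cases z with ⟨m, c, hc, rfl⟩ | ⟨m, a', c, r', hr', hw', rfl⟩
  · rw [corePoint_lt_lowPoint] at h1
    exact ⟨num s, hs, fun _ => corePoint_lt_lowPoint.2 h1⟩
  · rw [lowPoint_lt_lowPoint] at h1
    by_cases heq : m = n ∧ a' = a ∧ c = b
    · obtain ⟨rfl, rfl, rfl⟩ := heq
      obtain ⟨t, ht1, ht2⟩ := exists_between (show eta.elem r' < eta.elem r by simpa using h1)
      exact ⟨num t, ht2, fun _ => lowPoint_lt_lowPoint.2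
        (Or.inr ⟨rfl, Or.inr ⟨rfl, Or.inr ⟨rfl, ht1⟩⟩⟩)⟩
    · refine ⟨num s, hs, fun _ => lowPoint_lt_lowPoint.2 ?_⟩
      omega

theorem not_corePoint_zero_covBy {n : ℕ} {h0 : 0 < 2 * n + 2} {z : Coding} :
    ¬ corePoint n 0 h0 ⋖ z := by
  intro h
  rcases coding_cases z with ⟨m, c, hc, rfl⟩ | ⟨m, a', c, r', hr', hw', rfl⟩
  · have h1 := corePoint_lt_corePoint.1 h.1
    refine h.2 (c := lowPoint m 0 0 0 (lt_irrefl _) (witnesses_zero _ _)) ?_ ?_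
    · exact corePoint_lt_lowPoint.2 (by omega)
    · exact lowPoint_lt_corePoint.2 le_rfl
  · exact not_lowPoint_covBy h

theorem not_corePoint_covBy_corePoint {n b n' : ℕ} {hb : b < 2 * n + 2}
    {h : 2 * n' + 1 < 2 * n' + 2} :
    ¬ corePoint n b hb ⋖ corePoint n' (2 * n' + 1) h := by
  intro hcov
  have h1 := corePoint_lt_corePoint.1 hcov.1
  refine hcov.2 (c := lowPoint n' 0 0 0 (lt_irrefl _) (witnesses_zero _ _)) ?_ ?_
  · exact corePoint_lt_lowPoint.2 (by omega)
  · exact lowPoint_lt_corePoint.2 le_rfl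

/-- The first of the points at the centre has no immediate predecessor if the positions below
it are inhabited at infinitely many stages. Otherwise the last point of the last inhabited position
is its immediate predecessor. -/
theorem forall_not_covBy_corePoint_iff {n : ℕ} {h : 2 * n + 1 < 2 * n + 2} :
    (∀ z, ¬ z ⋖ corePoint n (2 * n + 1) h) ↔ DiagPi4 n := by
  rw [diagPi4_iff]
  constructor
  · intro hz
    by_contra hcon
    push Not at hcon
    classical
    obtain ⟨a, ha, hmax⟩ : ∃ a, (∃ b, Witnesses n a b) ∧ ∀ b, ¬ Witnesses n (a + 1) b := by
      by_contra hno
      push Not at hno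
      obtain ⟨a, ha⟩ := hcon
      obtain ⟨b, hb⟩ : ∃ b, Witnesses n a b := by
        clear ha
        induction a with
        | zero => exact ⟨0, witnesses_zero _ _⟩
        | succ a ih => exact hno a ih
      exact ha b hb
    refine hz (lowPoint n a (Nat.find ha) 0 (lt_irrefl _) (Nat.find_spec ha))
      ⟨lowPoint_lt_corePoint.2 le_rfl, fun w h1 h2 => ?_⟩
    rcases coding_cases w with ⟨m, c, hc, rfl⟩ | ⟨m, a', c, r', hr', hw', rfl⟩
    · rw [lowPoint_lt_corePoint] at h1
      rw [corePoint_lt_corePoint] at h2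
      omega
    · rw [lowPoint_lt_corePoint] at h2
      rw [lowPoint_lt_lowPoint] at h1
      obtain rfl : n = m := by omega
      have ha' : a' ≤ a := by
        by_contra hlt
        exact hmax c (hw'.mono (by omega))
      obtain rfl : a = a' := by omega
      have hc : Nat.find ha ≤ c := Nat.find_min' ha hw'
      simp only [lt_irrefl, true_and, false_or] at h1
      rcases h1 with h1 | h1
      · omega
      · exact hr' h1.2
  · intro hD z hz
    rcases coding_cases z with ⟨m, c, hc, rfl⟩ | ⟨m, a', c, r', hr', hw', rfl⟩
    · exact not_corePoint_covBy_corePoint hz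
    · have h1 := lowPoint_lt_corePoint.1 hz.1
      obtain ⟨b, hb⟩ := hD (a' + 1)
      refine hz.2 (c := lowPoint n (a' + 1) b 0 (lt_irrefl _) hb) (lowPoint_lt_lowPoint.2 ?_)
        (lowPoint_lt_corePoint.2 le_rfl)
      omega

/-- The maximal runs with more than one element are, for each `n`, one of length `2n + 2` if
`DiagPi4 n` holds, and one of length `2n + 3` otherwise. -/
theorem hasRun_coding_iff {n : ℕ} : HasRun Coding (2 * n + 1) ↔ DiagPi4 n := by
  constructor
  · rintro ⟨u, hu, h0, hk⟩
    have hcore : ∀ {j}, j < 2 * n + 1 → ∃ m b hb, u (j + 1) = corePoint m b hb := by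
      intro j hj
      rcases coding_cases (u (j + 1)) with h | ⟨m, a, b, r, hr, hw, h⟩
      · exact h
      · exact absurd (h ▸ hu j hj) not_lowPoint_covBy
    obtain ⟨m, b, hb, hlast⟩ := hcore (Nat.lt_succ_self (2 * n))
    obtain rfl : b = 0 := by
      rcases b with _ | b
      · rfl
      · exact absurd (hlast ▸ corePoint_covBy hb) (hk _)
    -- The run is determined from its last element backwards, as long as it stays at the centre.
    have hback : ∀ j, j ≤ 2 * n + 1 → ∀ hj : j < 2 * m + 2,
        u (2 * n + 1 - j) = corePoint m j hj := by
      intro j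
      induction j with
      | zero => exact fun _ _ => hlast
      | succ j ih =>
        intro hj hj'
        have h1 := hu (2 * n + 1 - (j + 1)) (by omega)
        rw [show 2 * n + 1 - (j + 1) + 1 = 2 * n + 1 - j by omega, ih (by omega) (by omega)] at h1
        exact h1.unique_left (corePoint_covBy hj')
    rcases lt_trichotomy n m with hlt | rfl | hlt
    · have h1 := hback (2 * n + 1) le_rfl (by omega)
      rw [Nat.sub_self] at h1
      refine absurd ?_ (h0 (corePoint m (2 * n + 1 + 1) (by omega)))
      rw [h1]
      exact corePoint_covBy _
    · have h1 := hback (2 * n + 1) le_rfl (by omega)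
      rw [Nat.sub_self] at h1
      rw [h1] at h0
      exact forall_not_covBy_corePoint_iff.1 h0
    · have h1 := hback (2 * m + 1) (by omega) (by omega)
      -- The run goes on below the centre, by at least two elements for reasons of parity.
      have h2 := hu (2 * n - (2 * m + 1)) (by omega)
      rw [show 2 * n - (2 * m + 1) + 1 = 2 * n + 1 - (2 * m + 1) by omega, h1] at h2
      obtain ⟨m', b', hb', h3⟩ := hcore (j := 2 * n - (2 * m + 1) - 1) (by omega)
      rw [show 2 * n - (2 * m + 1) - 1 + 1 = 2 * n - (2 * m + 1) by omega] at h3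
      rw [h3] at h2
      exact absurd h2 not_corePoint_covBy_corePoint
  · intro hD
    refine ⟨fun j => corePoint n (2 * n + 1 - j) (by omega), fun j hj => ?_, ?_, ?_⟩
    · have := corePoint_covBy (n := n) (b := 2 * n + 1 - (j + 1)) (by omega)
      have e : 2 * n + 1 - j = 2 * n + 1 - (j + 1) + 1 := by omega
      simp only [e]
      exact this
    · exact forall_not_covBy_corePoint_iff.2 hD
    · intro z
      simp only [Nat.sub_self]
      exact not_corePoint_zero_covBy

theorem not_hasPi1Copy_coding : ¬ HasPi1Copy Coding := by
  rintro ⟨M, P, hP, ⟨e⟩⟩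
  refine not_isSigma_diagPi4 ((isSigma_hasRun M hP).congr fun n => ?_)
  rw [← hasRun_coding_iff]
  exact ⟨fun h => h.of_orderIso e.symm, fun h => h.of_orderIso e⟩

theorem isPi2_centres {A : Set ℕ} (hA : IsPi2 A) : IsPi2 {n | ∃ i ∈ A, n = Nat.pair i 0} := by
  rw [isPi2_iff] at hA ⊢
  have h2 : ComputablePred fun n : ℕ => n.unpair.2 = 0 :=
    computablePred_natEq (Computable.snd.comp Computable.unpair) (Computable.const 0)
  refine ((hA.comp (Computable.fst.comp Computable.unpair)).and
    (IsPi.of_computablePred h2)).congr fun n => ?_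
  constructor
  · rintro ⟨i, hi, rfl⟩
    simpa using hi
  · rintro ⟨h1, h2⟩
    exact ⟨_, h1, by rw [← h2, Nat.pair_unpair]⟩

theorem HasPi1Copy.of_orderIso {α β : Type*} [LinearOrder α] [LinearOrder β] (h : HasPi1Copy α)
    (e : α ≃o β) : HasPi1Copy β := by
  obtain ⟨M, P, hP, ⟨f⟩⟩ := h
  exact ⟨M, P, hP, ⟨f.trans e⟩⟩

end BlockOrder

theorem mainTheorem5 :
    ∃ L : BlockOrder.ComputableLinearOrder,
      BlockOrder.HasCondensationTypeEta L ∧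
      (∀ I : Set L, I.OrdConnected → I.Infinite → ¬ BlockOrder.StronglyEtaLike I) ∧
      (∀ M : BlockOrder.ComputableLinearOrder, Nonempty (M ≃o L) → ¬ M.HasCEBlockRel) ∧
      ∃ (E : BlockOrder.ComputableLinearOrder) (A : Set ℕ),
        Nonempty (E ≃o ℚ) ∧ BlockOrder.IsPi2 A ∧
        ¬ BlockOrder.HasPi1Copy (E.Suborder A) ∧
        BlockOrder.IsPrimeBlockReplacement L E A := by
  obtain ⟨L, hL⟩ := BlockOrder.ComputableLinearOrder.exists_isPrimeBlockReplacement
    BlockOrder.codingOrder BlockOrder.isPi2_codingSet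
  have hE := BlockOrder.ComputableLinearOrder.nonempty_lex_eta_orderIso BlockOrder.codingOrder
  obtain ⟨e⟩ := BlockOrder.ComputableLinearOrder.nonempty_suborder_lex_orderIso
    BlockOrder.codingOrder BlockOrder.ComputableLinearOrder.eta BlockOrder.codingSet
  have hA := mt (fun h : BlockOrder.HasPi1Copy _ => h.of_orderIso e)
    BlockOrder.not_hasPi1Copy_coding
  exact ⟨L, hL.hasCondensationTypeEta hE, fun I hI _ => hL.not_stronglyEtaLike hE hI,
    fun M ⟨g⟩ hM => hA ((hL.of_orderIso g).hasPi1Copy hE hM), _, _, hE,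
    BlockOrder.isPi2_centres BlockOrder.isPi2_codingSet, hA, hL⟩
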